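/- Let $d\ge2$ and let $V\in L^1(\mathbb R^d)$ be real-valued and positive definite, that is, $\widehat V(k)=\int_{\mathbb R^d}e^{-ik\cdot x}V(x)\,dx$ is real and $\widehat V(k)\ge0$ for all $k\in\mathbb R^d$. Let $\mu(v)=\pi^{-d/2}e^{-|v|^2}$ and, for real-valued $g\in L^2(\mathbb R^d)$, let $F_g=\mu+\sqrt\mu\,g$. For $F:\mathbb R^d\to\mathbb R$ with integrable weak gradient $\nabla F$, the dispersion function is $$\varepsilon(k,k\cdot v;\nabla F)=1+\widehat V(k)\int_{\mathbb R^d}\frac{k\cdot\nabla F(v_*)}{k\cdot(v-v_*)-i0}\,dv_*,\qquad k,v\in\mathbb R^d,$$ where $-i0$ stands for the limit $\eta\downarrow0$ of the same integral with $-i\eta$. Write $\langle v\rangle=(1+|v|^2)^{1/2}$ and $\langle\nabla\rangle^s=(1-\Delta)^{s/2}$, the Fourier multiplier acting on tempered distributions. (i) The function $\varepsilon(k,k\cdot v;\nabla\mu)$ is well defined for all $k,v$, and there is a constant $C\ge1$, depending only on $d,V$, such that for all $k,v\in\mathbb R^d$, $$\tfrac1C\le|\varepsilon(k,k\cdot v;\nabla\mu)|\le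 C.$$ (ii) For all $r_0\ge0$ and $\delta_0>0$ there are constants $C_0,C\ge1$, depending only on $d,V,\delta_0,r_0$, such that for all $g\in L^2(\mathbb R^d)$ with $$\|\langle v\rangle^{-r_0}\langle\nabla\rangle^{\frac32+\delta_0}g\|_{L^2(\mathbb R^d)}\le\tfrac1{C_0},$$ the weak gradient $\nabla F_g$ exists and is integrable, $\varepsilon(k,k\cdot v;\nabla F_g)$ is well defined for all $k,v$, and for all $k,v\in\mathbb R^d$, $$\tfrac1C\le|\varepsilon(k,k\cdot v;\nabla F_g)|\le C.$$ (iii) For all multi-indices $\alpha\ne0$, all $\delta>0$ and $r\ge0$, there is a constant $C$, depending only on $d,V,\alpha,\delta,r$, such that for all $g\in L^2(\mathbb R^d)$ with $\|\langle v\rangle^{-r}\langle\nabla\rangle^{|\alpha|+\frac32+\delta}g\|_{L^2(\mathbb R^d)}<\infty$, the weak gradient $\nabla F_g$ exists and is integrable, $\varepsilon(k,k\cdot v;\nabla F_g)$ is well defined for all $k,v$, it is of class $C^{|\alpha|}$ in $v$, and for all $k,v\in\mathbb R^d$, $$|\nabla_v^\alpha\varepsilon(k,k\cdot v;\nabla F_g)|\le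 C\Big(1+\|\langle v\rangle^{-r}\langle\nabla\rangle^{|\alpha|+\frac32+\delta}g\|_{L^2(\mathbb R^d)}\Big).$$ -/

import Mathlib

open MeasureTheory Filter Topology
open scoped SchwartzMap ENNReal ContDiff

noncomputable section

namespace LenardBalescu

/-- The velocity / momentum space `ℝ^d` with its Euclidean structure. -/
abbrev Vel (d : ℕ) : Type := EuclideanSpace ℝ (Fin d)

variable {d : ℕ}

/-- The Fourier transform `V̂(k) = ∫ e^{-i k·x} V(x) dx`. -/
def potentialHat (V : Vel d → ℝ) (k : Vel d) : ℂ :=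
  ∫ x, Complex.exp (-(((inner ℝ k x : ℝ) : ℂ) * Complex.I)) * (V x : ℂ)

/-- Positive definiteness of an integrable interaction potential: its Fourier transform is real and
nonnegative everywhere. -/
def IsPositiveDefinite (V : Vel d → ℝ) : Prop :=
  ∀ k, 0 ≤ (potentialHat V k).re ∧ (potentialHat V k).im = 0

/-- The Maxwellian `μ(v) = π^{-d/2} e^{-|v|²}`. -/
def maxwellian (v : Vel d) : ℝ :=
  (1 / Real.pi) ^ ((d : ℝ) / 2) * Real.exp (-‖v‖ ^ 2)

/-- The perturbed density `F_g = μ + √μ g`. -/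
def perturbed (g : Vel d → ℝ) (v : Vel d) : ℝ :=
  maxwellian v + Real.sqrt (maxwellian v) * g v

/-- `G` is the weak (distributional) gradient of `F`: both are locally integrable and
`∫ F ∇φ = - ∫ φ G` for all `φ ∈ C_c^∞(ℝ^d)`. -/
def IsWeakGradient (F : Vel d → ℝ) (G : Vel d → Vel d) : Prop :=
  LocallyIntegrable F ∧ LocallyIntegrable G ∧
    ∀ φ : Vel d → ℝ, ContDiff ℝ ∞ φ → HasCompactSupport φ →
      ∫ v, F v • gradient φ v = -∫ v, φ v • G v

open Classical in
/-- The weak gradient `∇F`, which is unique up to null sets (`0` if there is none). -/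
def weakGradient (F : Vel d → ℝ) : Vel d → Vel d :=
  if h : ∃ G, IsWeakGradient F G then h.choose else 0

/-- The integral `∫ k·G(w) / (τ - k·w - iη) dw` at a positive regularization parameter `η`. -/
def cauchyIntegral (G : Vel d → Vel d) (k : Vel d) (τ η : ℝ) : ℂ :=
  ∫ w, ((inner ℝ k (G w) : ℝ) : ℂ) / (((τ - inner ℝ k w : ℝ) : ℂ) - (η : ℂ) * Complex.I)

/-- The dispersion function
`ε(k, τ; G) = 1 + V̂(k) ∫ k·G(w) / (τ - k·w - i0) dw`, where `-i0` stands for the limit `η ↓ 0` of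
`-iη`. It is used with `τ = k·v` and `G = ∇F`. -/
def dispersion (V : Vel d → ℝ) (k : Vel d) (τ : ℝ) (G : Vel d → Vel d) : ℂ :=
  1 + potentialHat V k * limUnder (𝓝[>] (0 : ℝ)) (fun η => cauchyIntegral G k τ η)

/-- The dispersion function `ε(k, k·v; ∇F)` is meaningful for all `k` and `v`: the density `F` has
an integrable weak gradient and the limit that defines the dispersion function exists. -/
def DispersionDefined (F : Vel d → ℝ) : Prop :=
  (∃ G, IsWeakGradient F G) ∧ Integrable (weakGradient F) ∧
    ∀ k v : Vel d, ∃ z : ℂ,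
      Tendsto (fun η => cauchyIntegral (weakGradient F) k (inner ℝ k v) η) (𝓝[>] (0 : ℝ)) (𝓝 z)

/-- The operator `⟨∇⟩^s = (1 - Δ)^{s/2}` on tempered distributions. Mathlib's Fourier transform
uses the phase `e^{-2πi x·ξ}`, so that the symbol of `⟨∇⟩^s` is `(1 + |2πξ|²)^{s/2}`. -/
def japaneseGradient (s : ℝ) (T : 𝓢'(Vel d, ℂ)) : 𝓢'(Vel d, ℂ) :=
  TemperedDistribution.fourierMultiplierCLM ℂ
    (fun ξ : Vel d => (((1 + ‖(2 * Real.pi) • ξ‖ ^ 2) ^ (s / 2) : ℝ) : ℂ)) T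

/-- Multiplication of a tempered distribution by the weight `⟨v⟩^{-r} = (1 + |v|²)^{-r/2}`. -/
def weightMul (r : ℝ) (T : 𝓢'(Vel d, ℂ)) : 𝓢'(Vel d, ℂ) :=
  TemperedDistribution.smulLeftCLM ℂ
    (fun v : Vel d => (((1 + ‖v‖ ^ 2) ^ (-r / 2) : ℝ) : ℂ)) T

/-- A real function in `L²` as a tempered distribution. -/
def asDistribution {g : Vel d → ℝ} (hg : MemLp g 2) : 𝓢'(Vel d, ℂ) :=
  Lp.toTemperedDistribution (hg.ofReal (K := ℂ)).toLp

/-- The norm `‖⟨v⟩^{-r} ⟨∇⟩^s g‖_{L²} ∈ [0, ∞]`: the `L²` norm of the function `h ∈ L²` which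
represents the tempered distribution `⟨v⟩^{-r} ⟨∇⟩^s g`, and `∞` if there is none. -/
def weightedSobolevNorm (r s : ℝ) {g : Vel d → ℝ} (hg : MemLp g 2) : ℝ≥0∞ :=
  ⨅ (h : Lp ℂ 2 (volume : Measure (Vel d)))
    (_ : weightMul r (japaneseGradient s (asDistribution hg)) = Lp.toTemperedDistribution h), ‖h‖ₑ

/-- The partial derivative `∂^α f = ∂_1^{α_1} ⋯ ∂_d^{α_d} f`, that is, the derivative of order `|α|`
evaluated at `α_1` copies of the basis vector `e_1`, …, `α_d` copies of `e_d`. -/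
def partialDeriv (α : Fin d → ℕ) (f : Vel d → ℂ) (v : Vel d) : ℂ :=
  iteratedFDeriv ℝ (∑ i, α i) f v
    (fun j => EuclideanSpace.single (finSigmaFinEquiv.symm j).1 (1 : ℝ))

end LenardBalescu

end

/-! For a unit vector `e` and `η > 0`, the resolvent `1/(y - iη)` is a Laplace integral over `t >
0`. Inserting it into the Cauchy integral and using Fubini leaves the Fourier transform of `e·∇F` at
`-te`, which equals `-2πi t F̂(-te)`. If `t F̂(-te)` is integrable on the half-line, dominated
convergence as `η ↓ 0` gives `4π² ∫_0^∞ t F̂(-te) e^{-2πitx} dt` (`tendsto_cauchyIntegral_unit`).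
Homogeneity in `k` extends this to every `k ≠ 0`, and at `k = 0` the dispersion function is 1.
Existence, upper bounds and derivative bounds thus all reduce to the moments `∫ (1+t)^n t |F̂(-te)|
dt`, uniformly in `e`.

For `√μ g` these moments rest on `dual_representation`. With `h = ⟨v⟩^{-r}⟨∇⟩^s g`, the transform of
`χ g` at `ζ` is the pairing of `ĥ` with a profile centred at `ζ`, rapidly decaying and of size
`⟨2πζ⟩^{-s}`. Squaring and integrating along a line costs no derivatives, because the decay of the
profile is integrable along lines uniformly in their position. Cauchy–Schwarz in `t` then costs
slightly more than half a derivative, and the factor `t` costs one more: this is the threshold `3/2`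
(`exists_rayMoment_perturbation_le`).

For the Maxwellian the boundary value is a positive multiple of `∫_0^∞ t e^{-π²t²} e^{-2πitx} dt`.
Its imaginary part comes from the derivative of a Gaussian and vanishes only at `x = 0`, where the
real part is nonnegative. Hence `1 + a·(...)` has no zero for `a ≥ 0`; Riemann–Lebesgue and
compactness make this uniform (`exists_le_norm_one_add_mul_halfGauss`). Part (ii) is a perturbation
of this bound, and part (iii) is differentiation under the half-line integral. -/

namespace LenardBalescu

/-! ### Symbol estimates for powers of `1 + c‖x‖²`. -/

section Symbol

variable {E : Type*} [NormedAddCommGroup E] [InnerProductSpace ℝ E]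

/-- Dividing by the value at `x` makes the quotient equal to 1 there, with derivatives bounded
independently of `x`: the first by Young's inequality, the second because it is constant and small,
the others because they vanish. The geometric form of the bound is the one needed for derivatives of
compositions. -/
theorem norm_iteratedFDeriv_norm_sq_le (c : ℝ) (hc : 0 ≤ c) (i : ℕ) (hi : 1 ≤ i) (x : E) :
    ‖iteratedFDeriv ℝ i (fun y : E => (1 + c * ‖y‖ ^ 2) / (1 + c * ‖x‖ ^ 2)) x‖ ≤
      (1 + 2 * c) ^ i := by
  have hq : 0 < 1 + c * ‖x‖ ^ 2 := by positivity
  set a : ℝ := (1 + c * ‖x‖ ^ 2)⁻¹ with ha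
  have ha0 : 0 < a := inv_pos.2 hq
  have ha1 : a ≤ 1 := inv_le_one_of_one_le₀ (by nlinarith [sq_nonneg ‖x‖, mul_nonneg hc (sq_nonneg ‖x‖)])
  let S : E →L[ℝ] E →L[ℝ] ℝ := innerSL ℝ
  have hS : ‖S‖ ≤ 1 := norm_innerSL_le _
  have hfd : fderiv ℝ (fun y : E => (1 + c * ‖y‖ ^ 2) / (1 + c * ‖x‖ ^ 2)) =
      fun y => ((2 * c * a) • S) y := by
    ext1 y
    have h := (((hasStrictFDerivAt_norm_sq y).hasFDerivAt.const_mul c).const_add 1).mul_const a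
    have h2 := h.fderiv
    simp only [div_eq_mul_inv]
    rw [← ha, h2]
    ext z
    change a * (c * (2 • inner ℝ y z)) = (2 * c * a) * inner ℝ y z
    rw [nsmul_eq_mul]; push_cast; ring
  have hnorm : ‖((2 * c * a) • S)‖ ≤ 2 * c * a := by
    refine (ContinuousLinearMap.opNorm_smul_le (2 * c * a) S).trans ?_
    rw [Real.norm_of_nonneg (by positivity)]
    exact mul_le_of_le_one_right (by positivity) hS
  have h1 : (1 : ℝ) ≤ 1 + 2 * c := by linarith
  obtain ⟨j, rfl⟩ : ∃ j, i = j + 1 := ⟨i - 1, by omega⟩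
  rw [← norm_iteratedFDeriv_fderiv, hfd]
  rcases j with _ | j
  · rw [norm_iteratedFDeriv_zero]
    refine (ContinuousLinearMap.le_of_opNorm_le _ hnorm x).trans ?_
    rw [zero_add, pow_one]
    have : a * ‖x‖ * c ≤ 1/2 + c/2 := by
      have h3 : a * (1 + c * ‖x‖ ^ 2) = 1 := inv_mul_cancel₀ hq.ne'
      nlinarith [sq_nonneg (‖x‖ - 1), mul_nonneg ha0.le (mul_nonneg hc (sq_nonneg (‖x‖ - 1))), mul_nonneg hc ha0.le, mul_nonneg hc (sub_nonneg.2 ha1)]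
    nlinarith
  · have key : ‖iteratedFDeriv ℝ (j + 1)
        (fun y => ((2 * c * a) • S) y) x‖ ≤ 2 * c * a := by
      rw [← norm_iteratedFDeriv_fderiv]
      have : fderiv ℝ (fun y => ((2 * c * a) • S) y) =
          fun _ => ((2 * c * a) • S) := by
        ext1 y; exact ContinuousLinearMap.fderiv _
      rw [this]
      rcases j with _ | j
      · rw [norm_iteratedFDeriv_zero]; exact hnorm
      · rw [iteratedFDeriv_const_of_ne (by omega)]
        simp; positivity
    refine key.trans ?_
    calc 2 * c * a ≤ 2 * c * 1 := by gcongr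
      _ ≤ 1 + 2 * c := by linarith
      _ ≤ _ := le_self_pow₀ h1 (by omega)

/-- The derivatives of `(1 + c‖x‖²)^p` are bounded by the function itself. -/
theorem exists_norm_iteratedFDeriv_rpow_le (c : ℝ) (hc : 0 ≤ c) (p : ℝ) (n : ℕ) :
    ∃ C : ℝ, 0 ≤ C ∧ ∀ i ≤ n, ∀ x : E,
      ‖iteratedFDeriv ℝ i (fun y : E => (1 + c * ‖y‖ ^ 2) ^ p) x‖ ≤ C * (1 + c * ‖x‖ ^ 2) ^ p := by
  let t : Set ℝ := Set.Ioi 0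
  let A : ℝ := ∑ i ∈ Finset.range (n + 1), ‖iteratedFDerivWithin ℝ i (fun y : ℝ => y ^ p) t 1‖
  have hA : 0 ≤ A := by positivity
  have h1c : (1 : ℝ) ≤ 1 + 2 * c := by linarith
  refine ⟨n.factorial * A * (1 + 2 * c) ^ n, by positivity, fun i hi x => ?_⟩
  have hq : 0 < 1 + c * ‖x‖ ^ 2 := by positivity
  have hdiff : ContDiffOn ℝ ∞ (fun y : ℝ => y ^ p) t :=
    contDiffOn_fun_id.rpow_const_of_ne fun y hy => (ne_of_gt hy)
  have hf : ContDiff ℝ ∞ (fun y : E => (1 + c * ‖y‖ ^ 2) / (1 + c * ‖x‖ ^ 2)) := by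
    have := contDiff_norm_sq (𝕜 := ℝ) (E := E) (n := ∞)
    fun_prop
  -- The outer power is differentiated only at 1, where the normalized quotient sits; hence `A` does
  -- not depend on `x`.
  have hcomp := norm_iteratedFDeriv_comp_le' (n := i) (N := ∞) (t := t)
    (f := fun y : E => (1 + c * ‖y‖ ^ 2) / (1 + c * ‖x‖ ^ 2)) (g := fun y : ℝ => y ^ p)
    (by rintro - ⟨y, rfl⟩; exact div_pos (by positivity) hq) (isOpen_Ioi.uniqueDiffOn)
    hdiff hf (by exact_mod_cast le_top) x (C := A) (D := 1 + 2 * c)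
    (by
      intro j hj
      rw [div_self hq.ne']
      exact Finset.single_le_sum (f := fun i => ‖iteratedFDerivWithin ℝ i (fun y : ℝ => y ^ p) t 1‖)
        (fun _ _ => norm_nonneg _) (Finset.mem_range.2 (by omega)))
    (fun j hj _ => norm_iteratedFDeriv_norm_sq_le c hc j hj x)
  have heq : (fun y : E => (1 + c * ‖y‖ ^ 2) ^ p) = fun y => ((1 + c * ‖x‖ ^ 2) ^ p) •
      ((fun y : ℝ => y ^ p) ∘ (fun y : E => (1 + c * ‖y‖ ^ 2) / (1 + c * ‖x‖ ^ 2))) y := by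
    ext y
    simp only [Function.comp, smul_eq_mul]
    rw [Real.div_rpow (by positivity) hq.le, mul_div_cancel₀]
    exact (Real.rpow_pos_of_pos hq _).ne'
  have hsm : ContDiffAt ℝ i ((fun y : ℝ => y ^ p) ∘
      (fun y : E => (1 + c * ‖y‖ ^ 2) / (1 + c * ‖x‖ ^ 2))) x := by
    have h3 : ContDiffAt ℝ ∞ ((fun y : ℝ => y ^ p) ∘
      (fun y : E => (1 + c * ‖y‖ ^ 2) / (1 + c * ‖x‖ ^ 2))) x :=
      hf.contDiffAt.rpow_const_of_ne (by rw [div_self hq.ne']; norm_num)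
    exact h3.of_le (by exact_mod_cast le_top)
  rw [heq, iteratedFDeriv_const_smul_apply' hsm, norm_smul,
    Real.norm_of_nonneg (by positivity), mul_comm]
  gcongr
  refine hcomp.trans ?_
  gcongr

end Symbol

/-- Peetre's inequality. -/
theorem one_add_norm_sq_rpow_neg_add_le {E : Type*} [NormedAddCommGroup E]
    (c : ℝ) (hc : 0 ≤ c) (p : ℝ) (hp : 0 ≤ p) (x ζ : E) :
    (1 + c * ‖x + ζ‖ ^ 2) ^ (-p) ≤ (2 * (1 + c)) ^ p * (1 + c * ‖ζ‖ ^ 2) ^ (-p) *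
      (1 + ‖x‖) ^ (2 * p) := by
  have h0 : 1 + c * ‖ζ‖ ^ 2 ≤ (2 * (1 + c)) * (1 + ‖x‖) ^ 2 * (1 + c * ‖x + ζ‖ ^ 2) := by
    have h1 : ‖ζ‖ ≤ ‖x‖ + ‖x + ζ‖ := by
      have := norm_sub_le (x + ζ) x
      simp at this; linarith
    have h2 : ‖ζ‖ ^ 2 ≤ 2 * ‖x‖ ^ 2 + 2 * ‖x + ζ‖ ^ 2 := by
      nlinarith [norm_nonneg ζ, norm_nonneg x, norm_nonneg (x + ζ), sq_nonneg (‖x‖ - ‖x + ζ‖)]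
    have h3 : 1 + c * ‖ζ‖ ^ 2 ≤ (2 * (1 + c)) * (1 + ‖x‖ ^ 2) * (1 + c * ‖x + ζ‖ ^ 2) := by
      have a1 := mul_le_mul_of_nonneg_left h2 hc
      have a2 : 0 ≤ c * ‖x‖ ^ 2 := by positivity
      have a3 : 0 ≤ c * ‖x + ζ‖ ^ 2 := by positivity
      have a4 : 0 ≤ ‖x‖ ^ 2 := by positivity
      nlinarith [mul_nonneg a2 a3, mul_nonneg hc a3, mul_nonneg a4 a3]
    refine h3.trans ?_
    gcongr
    nlinarith [norm_nonneg x]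
  have hq1 : 0 < 1 + c * ‖ζ‖ ^ 2 := by positivity
  have hq2 : 0 < 1 + c * ‖x + ζ‖ ^ 2 := by positivity
  have h4 := Real.rpow_le_rpow hq1.le h0 hp
  rw [Real.mul_rpow (by positivity) hq2.le, Real.mul_rpow (by positivity) (by positivity),
    ← Real.rpow_natCast (1 + ‖x‖) 2, ← Real.rpow_mul (by positivity)] at h4
  rw [Real.rpow_neg hq2.le, Real.rpow_neg hq1.le]
  have e1 : 0 < (1 + c * ‖ζ‖ ^ 2) ^ p := by positivity
  have e2 : 0 < (1 + c * ‖x + ζ‖ ^ 2) ^ p := by positivity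
  rw [inv_le_iff_one_le_mul₀ e2]
  push_cast at h4
  calc (1 : ℝ) = (1 + c * ‖ζ‖ ^ 2) ^ p * ((1 + c * ‖ζ‖ ^ 2) ^ p)⁻¹ := (mul_inv_cancel₀ e1.ne').symm
    _ ≤ _ := mul_le_mul_of_nonneg_right h4 (by positivity)
    _ = _ := by ring

end LenardBalescu

/-! ### Duality for the weighted Sobolev norm. -/

noncomputable section
namespace LenardBalescu

variable {d : ℕ}

open FourierTransform SchwartzMap

/-- The symbol `(1 + |2πξ|²)^{s/2}` of `⟨∇⟩^s`. -/
def bracketSymbol (s : ℝ) (ξ : Vel d) : ℝ := (1 + ‖(2 * Real.pi) • ξ‖ ^ 2) ^ (s / 2)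

theorem bracketSymbol_eq (s : ℝ) :
    bracketSymbol (d := d) s = fun ξ => (1 + (2 * Real.pi) ^ 2 * ‖ξ‖ ^ 2) ^ (s / 2) := by
  ext ξ
  rw [bracketSymbol, norm_smul, mul_pow, Real.norm_eq_abs, sq_abs]

theorem bracketSymbol_pos (s : ℝ) (ξ : Vel d) : 0 < bracketSymbol s ξ := by
  unfold bracketSymbol; positivity

theorem bracketSymbol_mul_neg (s : ℝ) (ξ : Vel d) :
    bracketSymbol s ξ * bracketSymbol (-s) ξ = 1 := by
  unfold bracketSymbol
  rw [← Real.rpow_add (by positivity)]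
  simp [neg_div]

theorem hasTemperateGrowth_bracketSymbol (s : ℝ) :
    Function.HasTemperateGrowth (bracketSymbol (d := d) s) := by
  have h1 := Function.hasTemperateGrowth_one_add_norm_sq_rpow (Vel d) (s / 2)
  have h2 : Function.HasTemperateGrowth (fun ξ : Vel d => (2 * Real.pi) • ξ) :=
    ((2 * Real.pi) • ContinuousLinearMap.id ℝ (Vel d)).hasTemperateGrowth
  exact h1.comp h2

theorem hasTemperateGrowth_bracketSymbol_add (s : ℝ) (ζ : Vel d) :
    Function.HasTemperateGrowth (fun ξ => bracketSymbol (d := d) s (ξ + ζ)) :=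
  (hasTemperateGrowth_bracketSymbol s).comp (Function.HasTemperateGrowth.id'.add (.const ζ))

/-- The Schwartz function `ξ ↦ (1 + |2π(ξ + ζ)|²)^{s/2} φ(ξ)`. -/
def symbolMul (s : ℝ) (ζ : Vel d) (φ : 𝓢(Vel d, ℂ)) : 𝓢(Vel d, ℂ) :=
  smulLeftCLM ℂ (fun ξ => bracketSymbol s (ξ + ζ)) φ

theorem symbolMul_apply (s : ℝ) (ζ : Vel d) (φ : 𝓢(Vel d, ℂ)) (ξ : Vel d) :
    symbolMul s ζ φ ξ = bracketSymbol s (ξ + ζ) • φ ξ :=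
  smulLeftCLM_apply_apply (hasTemperateGrowth_bracketSymbol_add s ζ) φ ξ

/-- By Leibniz, every derivative of the shifted symbol is controlled by the symbol at `x + ζ`.
Peetre's inequality moves it to `ζ` at the price of a power of `1 + ‖x‖`, which the decay of `φ`
absorbs. -/
theorem exists_seminorm_symbolMul_le (s : ℝ) (hs : 0 ≤ s) (φ : 𝓢(Vel d, ℂ)) (k n : ℕ) :
    ∃ C : ℝ, 0 ≤ C ∧ ∀ ζ : Vel d,
      SchwartzMap.seminorm ℂ k n (symbolMul (-s) ζ φ) ≤ C * bracketSymbol (-s) ζ := by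
  obtain ⟨C, hC, hCb⟩ := exists_norm_iteratedFDeriv_rpow_le (E := Vel d) ((2 * Real.pi) ^ 2)
    (by positivity) (-s / 2) n
  -- Peetre's inequality with exponent `s / 2` loses `(1 + ‖x‖)^s`; an integer `M ≥ s` lets Schwartz
  -- seminorms pay for it.
  obtain ⟨M, hM⟩ := exists_nat_ge s
  set c : ℝ := (2 * Real.pi) ^ 2 with hc
  let S : ℝ := 2 ^ (M + k) * (Finset.Iic ((M + k, n) : ℕ × ℕ)).sup
    (fun m => SchwartzMap.seminorm ℂ m.1 m.2) φ
  have hS : 0 ≤ S := by positivity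
  let K : ℝ := (2 * (1 + c)) ^ (s / 2)
  have hK : 0 ≤ K := by positivity
  refine ⟨∑ i ∈ Finset.range (n + 1), (n.choose i : ℝ) * (C * K * S), by positivity, fun ζ => ?_⟩
  have hb := bracketSymbol_pos (-s) ζ
  refine SchwartzMap.seminorm_le_bound ℂ k n _ (by positivity) fun x => ?_
  have hfun : (symbolMul (-s) ζ φ : Vel d → ℂ) = fun ξ => bracketSymbol (-s) (ξ + ζ) • φ ξ := by
    ext ξ; exact symbolMul_apply _ _ _ _
  rw [hfun]
  have hle := norm_iteratedFDeriv_smul_le (𝕜 := ℝ) (N := ∞)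
    (hasTemperateGrowth_bracketSymbol_add (-s) ζ).1 (φ.smooth ⊤) x (n := n)
    (by exact_mod_cast le_top)
  calc _ ≤ ‖x‖ ^ k * ∑ i ∈ Finset.range (n + 1), (n.choose i : ℝ) *
        ‖iteratedFDeriv ℝ i (fun ξ => bracketSymbol (-s) (ξ + ζ)) x‖ *
          ‖iteratedFDeriv ℝ (n - i) φ x‖ := by gcongr
    _ ≤ ∑ i ∈ Finset.range (n + 1), (n.choose i : ℝ) * (C * K * S) * bracketSymbol (-s) ζ := by
      rw [Finset.mul_sum]
      refine Finset.sum_le_sum fun i hi => ?_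
      have hi' : i ≤ n := by simpa [Nat.lt_succ_iff] using hi
      have h1 : ‖iteratedFDeriv ℝ i (fun ξ => bracketSymbol (-s) (ξ + ζ)) x‖ ≤
          C * (K * bracketSymbol (-s) ζ * (1 + ‖x‖) ^ M) := by
        rw [iteratedFDeriv_comp_add_right, bracketSymbol_eq]
        refine (hCb i hi' (x + ζ)).trans ?_
        gcongr
        have := one_add_norm_sq_rpow_neg_add_le c (by positivity) (s / 2) (by positivity) x ζ
        rw [neg_div]
        refine this.trans ?_
        gcongr
        rw [← Real.rpow_natCast]
        exact Real.rpow_le_rpow_of_exponent_le (by simp) (by linarith)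
      have h2 : (1 + ‖x‖) ^ (M + k) * ‖iteratedFDeriv ℝ (n - i) φ x‖ ≤ S :=
        one_add_le_sup_seminorm_apply (𝕜 := ℂ) (m := (M + k, n)) le_rfl (by simp) φ x
      have h3 : ‖x‖ ^ k ≤ (1 + ‖x‖) ^ k := by gcongr; simp
      calc _ ≤ (1 + ‖x‖) ^ k * ((n.choose i : ℝ) * (C * (K * bracketSymbol (-s) ζ * (1 + ‖x‖) ^ M)) *
            ‖iteratedFDeriv ℝ (n - i) φ x‖) := by gcongr
        _ = (n.choose i : ℝ) * (C * K * ((1 + ‖x‖) ^ (M + k) * ‖iteratedFDeriv ℝ (n - i) φ x‖)) *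
            bracketSymbol (-s) ζ := by rw [pow_add]; ring
        _ ≤ _ := by gcongr
    _ = _ := by rw [Finset.sum_mul]

/-- A continuous linear map on Schwartz space preserves uniform seminorm bounds of a family. -/
theorem exists_seminorm_clm_le {ι : Type*} (A : 𝓢(Vel d, ℂ) →L[ℂ] 𝓢(Vel d, ℂ))
    (u : ι → 𝓢(Vel d, ℂ)) (b : ι → ℝ) (hb : ∀ i, 0 ≤ b i)
    (hu : ∀ k n : ℕ, ∃ C : ℝ, 0 ≤ C ∧ ∀ i, SchwartzMap.seminorm ℂ k n (u i) ≤ C * b i)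
    (k n : ℕ) :
    ∃ C : ℝ, 0 ≤ C ∧ ∀ i, SchwartzMap.seminorm ℂ k n (A (u i)) ≤ C * b i := by
  let q : Seminorm ℂ 𝓢(Vel d, ℂ) := (SchwartzMap.seminorm ℂ k n).comp A.toLinearMap
  have hq : Continuous q := by
    have h1 : Continuous (SchwartzMap.seminorm ℂ k n : 𝓢(Vel d, ℂ) → ℝ) :=
      (schwartz_withSeminorms ℂ (Vel d) ℂ).continuous_seminorm (k, n)
    exact h1.comp A.continuous
  obtain ⟨s, C, -, hC⟩ := Seminorm.bound_of_continuous (schwartz_withSeminorms ℂ (Vel d) ℂ) q hq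
  choose D hD hDb using hu
  refine ⟨C * ∑ p ∈ s, D p.1 p.2, ?_, fun i => ?_⟩
  · have : ∀ p ∈ s, 0 ≤ D p.1 p.2 := fun p _ => hD _ _
    exact mul_nonneg C.2 (Finset.sum_nonneg this)
  · have h1 := hC (u i)
    refine h1.trans ?_
    rw [_root_.smul_apply, NNReal.smul_def, smul_eq_mul, mul_assoc]
    refine mul_le_mul_of_nonneg_left ?_ C.2
    have h0 : 0 ≤ ∑ p ∈ s, D p.1 p.2 := Finset.sum_nonneg fun p _ => hD _ _
    refine Seminorm.finset_sup_apply_le (mul_nonneg h0 (hb i)) fun p hp => ?_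
    refine (hDb p.1 p.2 i).trans ?_
    refine mul_le_mul_of_nonneg_right ?_ (hb i)
    exact Finset.single_le_sum (f := fun p : ℕ × ℕ => D p.1 p.2) (fun p _ => hD _ _) hp

/-- The profile of the dual of the weighted operator: `𝓕⁻¹ ⟨v⟩^r 𝓕 (⟨· + ζ⟩^{-s} 𝓕⁻¹ χ)`. -/
def dualProfile (r s : ℝ) (χ : 𝓢(Vel d, ℂ)) (ζ : Vel d) : 𝓢(Vel d, ℂ) :=
  𝓕⁻ (smulLeftCLM ℂ (fun v : Vel d => (((1 + ‖v‖ ^ 2) ^ (r / 2) : ℝ) : ℂ))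
    (𝓕 (symbolMul (-s) ζ (𝓕⁻ χ))))

/-- The operator `𝓕⁻¹ ⟨v⟩^r 𝓕` does not depend on `ζ` and is continuous on Schwartz space, so the
size `⟨2πζ⟩^{-s}` of its argument in every seminorm survives. -/
theorem exists_dualProfile_le (r s : ℝ) (hs : 0 ≤ s) (χ : 𝓢(Vel d, ℂ)) (N : ℕ) :
    ∃ C : ℝ, 0 ≤ C ∧ ∀ ζ x : Vel d,
      (1 + ‖x‖) ^ N * ‖dualProfile r s χ ζ x‖ ≤ C * bracketSymbol (-s) ζ := by
  let A : 𝓢(Vel d, ℂ) →L[ℂ] 𝓢(Vel d, ℂ) := fourierInvCLM ℂ 𝓢(Vel d, ℂ) ∘L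
    (smulLeftCLM ℂ (fun v : Vel d => (((1 + ‖v‖ ^ 2) ^ (r / 2) : ℝ) : ℂ))) ∘L
      fourierCLM ℂ 𝓢(Vel d, ℂ)
  have hA := exists_seminorm_clm_le A (fun ζ => symbolMul (-s) ζ (𝓕⁻ χ)) (bracketSymbol (-s))
    (fun ζ => (bracketSymbol_pos _ _).le) (exists_seminorm_symbolMul_le s hs (𝓕⁻ χ))
  choose D hD hDb using hA
  refine ⟨2 ^ N * ∑ p ∈ Finset.Iic ((N, 0) : ℕ × ℕ), D p.1 p.2, ?_, fun ζ x => ?_⟩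
  · exact mul_nonneg (by positivity) (Finset.sum_nonneg fun p _ => hD _ _)
  have h1 := one_add_le_sup_seminorm_apply (𝕜 := ℂ) (m := (N, 0)) le_rfl le_rfl
    (dualProfile r s χ ζ) x
  rw [norm_iteratedFDeriv_zero] at h1
  refine h1.trans ?_
  rw [mul_assoc]
  refine mul_le_mul_of_nonneg_left ?_ (by positivity)
  have hb := (bracketSymbol_pos (-s) ζ).le
  refine Seminorm.finset_sup_apply_le
    (mul_nonneg (Finset.sum_nonneg fun p _ => hD _ _) hb) fun p hp => ?_
  refine (hDb p.1 p.2 ζ).trans (mul_le_mul_of_nonneg_right ?_ hb)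
  exact Finset.single_le_sum (f := fun p : ℕ × ℕ => D p.1 p.2) (fun p _ => hD _ _) hp

theorem fourier_compSubConst_apply (φ : 𝓢(Vel d, ℂ)) (ζ v : Vel d) :
    𝓕 (compSubConstCLM ℂ ζ φ) v = Real.fourierChar (-inner ℝ v ζ) • 𝓕 φ v := by
  rw [fourier_coe, fourier_coe, Real.fourier_eq, Real.fourier_eq]
  simp only [compSubConstCLM_apply]
  rw [← integral_sub_right_eq_self (fun x => Real.fourierChar (-inner ℝ x v) • φ x) ζ,
    Circle.smul_def, ← integral_smul]
  congr with x
  rw [inner_sub_left, Circle.smul_def, Circle.smul_def, smul_smul, ← Circle.coe_mul,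
    ← AddChar.map_add_eq_mul, real_inner_comm]
  congr 4
  rw [real_inner_comm v ζ]
  ring

/-- The `L²` function `h` represents the tempered distribution `⟨v⟩^{-r} ⟨∇⟩^s g`. -/
def Represents (r s : ℝ) {g : Vel d → ℝ} (hg : MemLp g 2)
    (h : Lp ℂ 2 (volume : Measure (Vel d))) : Prop :=
  weightMul r (japaneseGradient s (asDistribution hg)) = Lp.toTemperedDistribution h

/-- The identity defining `h` is tested on a Schwartz function for which the transposed weight and
multiplier cancel, leaving `χ` times the character of frequency `ζ`. Pairing that with `g` is the
Fourier transform of `χ g` at `ζ`; on the other side the outer Fourier transform is moved onto `h`.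
-/
theorem dual_representation (r s : ℝ) {g : Vel d → ℝ} (hg : MemLp g 2)
    (h : Lp ℂ 2 (volume : Measure (Vel d)))
    (hh : Represents r s hg h)
    (χ : 𝓢(Vel d, ℂ)) (ζ : Vel d) :
    𝓕 (fun v => χ v * (g v : ℂ)) ζ =
      ∫ ξ, dualProfile r s χ ζ (ξ - ζ) * (𝓕 h : Lp ℂ 2 (volume : Measure (Vel d))) ξ := by
  let wr : ℝ → Vel d → ℂ := fun r v => (((1 + ‖v‖ ^ 2) ^ (r / 2) : ℝ) : ℂ)
  have hwr : ∀ r, Function.HasTemperateGrowth (wr r) := fun r =>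
    Function.HasTemperateGrowth.comp Function.Complex.hasTemperateGrowth_ofReal
      (Function.hasTemperateGrowth_one_add_norm_sq_rpow (Vel d) (r / 2))
  have hms : Function.HasTemperateGrowth (fun ξ : Vel d => ((bracketSymbol s ξ : ℝ) : ℂ)) :=
    Function.HasTemperateGrowth.comp Function.Complex.hasTemperateGrowth_ofReal (hasTemperateGrowth_bracketSymbol s)
  let ψ : 𝓢(Vel d, ℂ) := 𝓕 (compSubConstCLM ℂ ζ (dualProfile r s χ ζ))
  have hψ : smulLeftCLM ℂ (wr (-r)) ψ = 𝓕 (compSubConstCLM ℂ ζ (symbolMul (-s) ζ (𝓕⁻ χ))) := by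
    ext v
    rw [smulLeftCLM_apply_apply (hwr _), fourier_compSubConst_apply, fourier_compSubConst_apply,
      dualProfile, fourier_fourierInv_eq, smulLeftCLM_apply_apply (hwr r), Circle.smul_def,
      Circle.smul_def]
    simp only [smul_eq_mul, wr]
    have : ((((1 + ‖v‖ ^ 2) ^ (-r / 2) : ℝ) : ℂ)) * (((1 + ‖v‖ ^ 2) ^ (r / 2) : ℝ) : ℂ) = 1 := by
      rw [← Complex.ofReal_mul, ← Real.rpow_add (by positivity)]
      simp [neg_div]
    linear_combination (Real.fourierChar (-inner ℝ v ζ) *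
      𝓕 (symbolMul (-s) ζ (𝓕⁻ χ)) v : ℂ) * this
  -- After translation by `ζ`, the shifted symbol of order `-s` becomes the unshifted one and
  -- cancels `⟨∇⟩^s`.
  have hJ : 𝓕 (smulLeftCLM ℂ (fun ξ : Vel d => ((bracketSymbol s ξ : ℝ) : ℂ))
      (𝓕⁻ (smulLeftCLM ℂ (wr (-r)) ψ))) = 𝓕 (compSubConstCLM ℂ ζ (𝓕⁻ χ)) := by
    rw [hψ, fourierInv_fourier_eq]
    congr 1
    ext ξ
    rw [smulLeftCLM_apply_apply hms, compSubConstCLM_apply, compSubConstCLM_apply, symbolMul_apply,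
      sub_add_cancel, Complex.real_smul, smul_eq_mul, ← mul_assoc, ← Complex.ofReal_mul,
      bracketSymbol_mul_neg, Complex.ofReal_one, one_mul]
  have h1 := DFunLike.congr_fun hh ψ
  have h2 : weightMul r (japaneseGradient s (asDistribution hg)) ψ =
      asDistribution hg (𝓕 (compSubConstCLM ℂ ζ (𝓕⁻ χ))) := by
    rw [← hJ]; rfl
  have h3 : Lp.toTemperedDistribution h ψ = Lp.toTemperedDistribution
      (𝓕 h : Lp ℂ 2 (volume : Measure (Vel d))) (compSubConstCLM ℂ ζ (dualProfile r s χ ζ)) := by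
    rw [← Lp.fourier_toTemperedDistribution_eq]; rfl
  rw [h2, h3, asDistribution, Lp.toTemperedDistribution_apply, Lp.toTemperedDistribution_apply] at h1
  simp only [compSubConstCLM_apply, smul_eq_mul] at h1
  rw [← h1, Real.fourier_eq]
  refine integral_congr_ae ?_
  filter_upwards [(hg.ofReal (K := ℂ)).coeFn_toLp] with v hv
  rw [hv, fourier_compSubConst_apply, fourier_fourierInv_eq, Circle.smul_def, Circle.smul_def]
  simp [mul_assoc]

end LenardBalescu
end

/-! ### Weighted Fourier bounds, globally and along lines. -/

noncomputable section
namespace LenardBalescu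

variable {d : ℕ}

open FourierTransform SchwartzMap

theorem sq_lintegral_mul_le {α : Type*} [MeasurableSpace α] (μ : Measure α) {f g : α → ℝ≥0∞}
    (hf : AEMeasurable f μ) (hg : AEMeasurable g μ) :
    (∫⁻ a, f a * g a ∂μ) ^ 2 ≤ (∫⁻ a, f a ^ 2 ∂μ) * ∫⁻ a, g a ^ 2 ∂μ := by
  have h := ENNReal.lintegral_mul_le_Lp_mul_Lq μ Real.HolderConjugate.two_two hf hg
  have h2 := pow_le_pow_left' h 2
  refine h2.trans (le_of_eq ?_)
  rw [mul_pow]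
  simp only [← ENNReal.rpow_natCast, ← ENNReal.rpow_mul]
  norm_num

/-- The polynomially decaying kernel `(1 + ‖x‖)^{-N}`. -/
def decay {E : Type*} [NormedAddCommGroup E] (N : ℝ) (x : E) : ℝ≥0∞ :=
  ENNReal.ofReal ((1 + ‖x‖) ^ (-N))

theorem measurable_decay {E : Type*} [NormedAddCommGroup E] [MeasurableSpace E] [BorelSpace E]
    (N : ℝ) : Measurable (decay N : E → ℝ≥0∞) := by
  unfold decay; fun_prop

theorem decay_sq {E : Type*} [NormedAddCommGroup E] (N : ℝ) (x : E) :
    decay N x ^ 2 = decay (2 * N) x := by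
  unfold decay
  rw [← ENNReal.ofReal_pow (by positivity), ← Real.rpow_natCast, ← Real.rpow_mul (by positivity)]
  congr 2
  push_cast
  ring

theorem lintegral_decay_lt_top {E : Type*} [NormedAddCommGroup E] [NormedSpace ℝ E]
    [FiniteDimensional ℝ E] [MeasurableSpace E] [BorelSpace E] (μ : Measure E) [μ.IsAddHaarMeasure]
    {N : ℝ} (hN : (Module.finrank ℝ E : ℝ) < N) : ∫⁻ x : E, decay N x ∂μ < ⊤ := by
  unfold decay
  exact finite_integral_one_add_norm hN

theorem enorm_toLp_sq {E : Type*} [MeasurableSpace E] {μ : Measure E} (h : Lp ℂ 2 μ) :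
    ∫⁻ x, ‖h x‖ₑ ^ 2 ∂μ = ‖h‖ₑ ^ 2 := by
  rw [Lp.enorm_def, eLpNorm_eq_lintegral_rpow_enorm_toReal (by simp) (by simp)]
  simp only [← ENNReal.rpow_natCast, ← ENNReal.rpow_mul]
  norm_num

theorem enorm_fourier_eq (h : Lp ℂ 2 (volume : Measure (Vel d))) :
    ‖(𝓕 h : Lp ℂ 2 (volume : Measure (Vel d)))‖ₑ = ‖h‖ₑ := by
  rw [← ofReal_norm, Lp.norm_fourier_eq, ofReal_norm]

/-- Cauchy–Schwarz in the dual representation. The decaying kernel remains on the right, so that a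
later integration in `ζ` over a measure of any dimension can use it. -/
theorem exists_enorm_fourier_sq_le (r s : ℝ) (hs : 0 ≤ s) (χ : 𝓢(Vel d, ℂ)) :
    ∃ C : ℝ≥0∞, C < ⊤ ∧ ∀ {g : Vel d → ℝ} (hg : MemLp g 2 volume)
      (h : Lp ℂ 2 (volume : Measure (Vel d))),
      Represents r s hg h →
      ∀ ζ : Vel d,
        (ENNReal.ofReal (bracketSymbol s ζ) * ‖𝓕 (fun v => χ v * (g v : ℂ)) ζ‖ₑ) ^ 2 ≤
          C * ∫⁻ ξ, decay (2 * (d + 2)) (ξ - ζ) *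
            ‖(𝓕 h : Lp ℂ 2 (volume : Measure (Vel d))) ξ‖ₑ ^ 2 := by
  obtain ⟨C, hC, hCb⟩ := exists_dualProfile_le r s hs χ (2 * (d + 2))
  let D : ℝ≥0∞ := ∫⁻ x : Vel d, decay (2 * (d + 2)) x
  have hD : D < ⊤ := lintegral_decay_lt_top volume (by
    simp only [finrank_euclideanSpace, Fintype.card_fin]; linarith [(Nat.cast_nonneg d : (0:ℝ) ≤ d)])
  refine ⟨ENNReal.ofReal C ^ 2 * D, ENNReal.mul_lt_top (by simp) hD,
    fun {g} hg h hh ζ => ?_⟩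
  rw [dual_representation r s hg h hh χ ζ]
  set H := (𝓕 h : Lp ℂ 2 (volume : Measure (Vel d)))
  have hbs := bracketSymbol_pos s ζ
  have hHm : AEMeasurable (fun ξ => ‖H ξ‖ₑ) := (Lp.aestronglyMeasurable H).enorm
  have hdm : ∀ N, Measurable fun ξ : Vel d => decay N (ξ - ζ) := fun N =>
    (measurable_decay N).comp (measurable_id.sub_const ζ)
  have hpt : ∀ x, ENNReal.ofReal (bracketSymbol s ζ) * ‖dualProfile r s χ ζ x‖ₑ ≤
      ENNReal.ofReal C * decay (2 * (d + 2)) x := by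
    intro x
    unfold decay
    rw [← ofReal_norm, ← ENNReal.ofReal_mul hbs.le, ← ENNReal.ofReal_mul hC]
    refine ENNReal.ofReal_le_ofReal ?_
    have h1 := hCb ζ x
    have hx : (0 : ℝ) < (1 + ‖x‖) ^ (2 * (d + 2)) := by positivity
    have h2 : (1 + ‖x‖) ^ (-(2 * ((d : ℝ) + 2))) = ((1 + ‖x‖) ^ (2 * (d + 2)))⁻¹ := by
      rw [Real.rpow_neg (by positivity), ← Real.rpow_natCast]; push_cast; rfl
    rw [h2, ← div_eq_mul_inv, le_div_iff₀ hx]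
    calc _ = bracketSymbol s ζ * ((1 + ‖x‖) ^ (2 * (d + 2)) * ‖dualProfile r s χ ζ x‖) := by ring
      _ ≤ bracketSymbol s ζ * (C * bracketSymbol (-s) ζ) := by gcongr
      _ = C * (bracketSymbol s ζ * bracketSymbol (-s) ζ) := by ring
      _ = C := by rw [bracketSymbol_mul_neg, mul_one]
  calc (ENNReal.ofReal (bracketSymbol s ζ) * ‖∫ ξ, dualProfile r s χ ζ (ξ - ζ) * H ξ‖ₑ) ^ 2
      ≤ (ENNReal.ofReal (bracketSymbol s ζ) *
          ∫⁻ ξ, ‖dualProfile r s χ ζ (ξ - ζ) * H ξ‖ₑ) ^ 2 := by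
        gcongr; exact enorm_integral_le_lintegral_enorm _
    _ = (∫⁻ ξ, ENNReal.ofReal (bracketSymbol s ζ) * ‖dualProfile r s χ ζ (ξ - ζ) * H ξ‖ₑ) ^ 2 := by
        rw [lintegral_const_mul' _ _ ENNReal.ofReal_ne_top]
    -- The decay `2(d + 2)` is split evenly: the square of one half is integrable on `ℝ^d`, and the
    -- other half stays with `H`.
    _ ≤ (∫⁻ ξ, ENNReal.ofReal C * (decay (d + 2) (ξ - ζ) *
          (decay (d + 2) (ξ - ζ) * ‖H ξ‖ₑ))) ^ 2 := by
        refine pow_le_pow_left' (lintegral_mono fun ξ => ?_) 2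
        rw [enorm_mul, ← mul_assoc]
        refine (mul_le_mul_left (hpt (ξ - ζ)) _).trans (le_of_eq ?_)
        rw [← decay_sq]; ring
    _ = ENNReal.ofReal C ^ 2 * (∫⁻ ξ, decay (d + 2) (ξ - ζ) *
          (decay (d + 2) (ξ - ζ) * ‖H ξ‖ₑ)) ^ 2 := by
        rw [lintegral_const_mul' _ _ ENNReal.ofReal_ne_top, mul_pow]
    _ ≤ ENNReal.ofReal C ^ 2 * ((∫⁻ ξ, decay (d + 2) (ξ - ζ) ^ 2) *
          ∫⁻ ξ, (decay (d + 2) (ξ - ζ) * ‖H ξ‖ₑ) ^ 2) := by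
        gcongr
        exact sq_lintegral_mul_le _ (hdm _).aemeasurable ((hdm _).aemeasurable.mul hHm)
    _ = _ := by
        simp only [mul_pow, decay_sq]
        rw [lintegral_sub_right_eq_self (fun x => decay (2 * ((d : ℝ) + 2)) x) ζ]
        simp only [D, mul_assoc]

/-- Abstract form of integrating the pointwise bound along a family of frequencies. -/
theorem exists_lintegral_enorm_fourier_sq_le (r s : ℝ) (hs : 0 ≤ s) (χ : 𝓢(Vel d, ℂ)) :
    ∃ C : ℝ≥0∞, C < ⊤ ∧ ∀ {g : Vel d → ℝ} (hg : MemLp g 2 volume)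
      (h : Lp ℂ 2 (volume : Measure (Vel d))),
      Represents r s hg h →
      (∫⁻ ζ, (ENNReal.ofReal (bracketSymbol s ζ) * ‖𝓕 (fun v => χ v * (g v : ℂ)) ζ‖ₑ) ^ 2 ≤
          C * ‖h‖ₑ ^ 2) ∧
      ∀ e : Vel d, ‖e‖ = 1 →
        ∫⁻ t : ℝ, (ENNReal.ofReal (bracketSymbol s (t • e)) *
          ‖𝓕 (fun v => χ v * (g v : ℂ)) (t • e)‖ₑ) ^ 2 ≤ C * ‖h‖ₑ ^ 2 := by
  obtain ⟨C, hC, hCb⟩ := exists_enorm_fourier_sq_le r s hs χ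
  have hd0 : (0 : ℝ) ≤ d := Nat.cast_nonneg d
  let D : ℝ≥0∞ := ∫⁻ x : Vel d, decay (2 * (d + 2)) x
  have hD : D < ⊤ := lintegral_decay_lt_top volume (by
    simp only [finrank_euclideanSpace, Fintype.card_fin]; linarith)
  let D' : ℝ≥0∞ := ∫⁻ x : ℝ, decay (2 * (d + 2)) x
  have hD' : D' < ⊤ := lintegral_decay_lt_top volume (by
    simp only [Module.finrank_self, Nat.cast_one]; linarith)
  -- Tonelli and Plancherel reduce every family of frequencies `γ` to a bound on the integral of the
  -- kernel over the family, uniform in `ξ`. It is applied to all of `ℝ^d` and to lines through the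
  -- origin.
  have key : ∀ {α : Type} [MeasurableSpace α] (μ : Measure α) [SFinite μ] (γ : α → Vel d)
      (_ : Measurable γ) (K : ℝ≥0∞) (_ : ∀ ξ, ∫⁻ a, decay (2 * (d + 2)) (ξ - γ a) ∂μ ≤ K)
      {g : Vel d → ℝ} (hg : MemLp g 2 volume) (h : Lp ℂ 2 (volume : Measure (Vel d))),
      Represents r s hg h →
      ∫⁻ a, (ENNReal.ofReal (bracketSymbol s (γ a)) *
        ‖𝓕 (fun v => χ v * (g v : ℂ)) (γ a)‖ₑ) ^ 2 ∂μ ≤ C * (K * ‖h‖ₑ ^ 2) := by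
    intro α _ μ _ γ hγ K hK g hg h hh
    set H := (𝓕 h : Lp ℂ 2 (volume : Measure (Vel d))) with hH
    have hHm : AEMeasurable (fun ξ => ‖H ξ‖ₑ ^ 2) :=
      (Lp.aestronglyMeasurable H).enorm.pow_const 2
    calc _ ≤ ∫⁻ a, (C * ∫⁻ ξ, decay (2 * (d + 2)) (ξ - γ a) * ‖H ξ‖ₑ ^ 2) ∂μ :=
          lintegral_mono fun a => hCb hg h hh (γ a)
      _ = C * ∫⁻ a, (∫⁻ ξ, decay (2 * (d + 2)) (ξ - γ a) * ‖H ξ‖ₑ ^ 2) ∂μ :=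
          lintegral_const_mul' _ _ hC.ne
      _ = C * ∫⁻ ξ, (∫⁻ a, decay (2 * (d + 2)) (ξ - γ a) * ‖H ξ‖ₑ ^ 2 ∂μ) := by
          congr 1
          refine lintegral_lintegral_swap ?_
          refine AEMeasurable.mul (M := ℝ≥0∞) ?_ ?_
          · exact ((measurable_decay _).comp
              (measurable_snd.sub (hγ.comp measurable_fst))).aemeasurable
          · exact hHm.comp_snd
      _ = C * ∫⁻ ξ, (∫⁻ a, decay (2 * (d + 2)) (ξ - γ a) ∂μ) * ‖H ξ‖ₑ ^ 2 := by
          congr 2 with ξ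
          refine lintegral_mul_const _ ?_
          exact (measurable_decay _).comp (measurable_const.sub hγ)
      _ ≤ C * ∫⁻ ξ, K * ‖H ξ‖ₑ ^ 2 := by gcongr with ξ; exact hK ξ
      _ = C * (K * ‖h‖ₑ ^ 2) := by
          rw [lintegral_const_mul'' _ hHm, enorm_toLp_sq, hH, enorm_fourier_eq]
  refine ⟨C * (D + D'), ENNReal.mul_lt_top hC (ENNReal.add_lt_top.2 ⟨hD, hD'⟩),
    fun {g} hg h hh => ⟨?_, fun e he => ?_⟩⟩
  · rw [mul_assoc]
    refine key volume id measurable_id _ (fun ξ => ?_) hg h hh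
    simp only [id]
    rw [lintegral_sub_left_eq_self (fun x => decay (2 * ((d : ℝ) + 2)) x) ξ]
    exact le_self_add
  · rw [mul_assoc]
    refine key volume (fun t : ℝ => t • e) (by fun_prop) _ (fun ξ => ?_) hg h hh
    -- Projecting onto `e` only shortens `ξ - t • e`, leaving a translate of a one-dimensional
    -- integral independent of `ξ` and `e`.
    calc ∫⁻ t : ℝ, decay (2 * (d + 2)) (ξ - t • e)
        ≤ ∫⁻ t : ℝ, decay (2 * (d + 2)) (inner ℝ ξ e - t) := by
          refine lintegral_mono fun t => ENNReal.ofReal_le_ofReal ?_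
          refine Real.rpow_le_rpow_of_nonpos (by positivity) ?_ (by linarith)
          gcongr
          have : inner ℝ (ξ - t • e) e = inner ℝ ξ e - t := by
            rw [inner_sub_left, inner_smul_left, real_inner_self_eq_norm_sq, he]; simp
          rw [← this]
          have := norm_inner_le_norm (𝕜 := ℝ) (ξ - t • e) e
          rwa [he, mul_one] at this
      _ = D' := lintegral_sub_left_eq_self (fun x : ℝ => decay (2 * ((d : ℝ) + 2)) x) _
      _ ≤ D + D' := le_add_self

theorem MemLp.integrable_schwartz_mul {g : Vel d → ℝ} (hg : MemLp g 2 volume) (χ : 𝓢(Vel d, ℂ)) :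
    Integrable (fun v => χ v * (g v : ℂ)) :=
  (χ.memLp 2).integrable_mul (hg.ofReal (K := ℂ))

theorem continuous_fourier_of_integrable {f : Vel d → ℂ} (hf : Integrable f) :
    Continuous (𝓕 f) :=
  VectorFourier.fourierIntegral_continuous Real.continuous_fourierChar
    (L := innerₗ (Vel d)) continuous_inner hf

theorem one_add_abs_rpow_le_bracketSymbol (s : ℝ) (hs : 0 ≤ s) (t : ℝ) {e : Vel d} (he : ‖e‖ = 1) :
    (1 + ‖t‖) ^ s ≤ 2 ^ (s / 2) * bracketSymbol s (t • e) := by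
  rw [bracketSymbol_eq]
  simp only [norm_smul, he, mul_one]
  rw [← Real.mul_rpow (by norm_num) (by positivity)]
  have h1 : (1 + ‖t‖) ^ s = ((1 + ‖t‖) ^ 2) ^ (s / 2) := by
    rw [← Real.rpow_natCast, ← Real.rpow_mul (by positivity)]
    congr 1; push_cast; ring
  rw [h1]
  refine Real.rpow_le_rpow (by positivity) ?_ (by positivity)
  have hpi := Real.pi_gt_three
  have : (1:ℝ) ≤ (2 * Real.pi) ^ 2 := by nlinarith
  nlinarith [sq_nonneg (‖t‖ - 1), mul_le_mul_of_nonneg_right this (sq_nonneg ‖t‖)]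

/-- Cauchy–Schwarz against `(1 + |t|)^{-(s-b)}`, which is square integrable on the line because `s -
b > 1/2`. -/
theorem exists_lintegral_moment_le (r s b : ℝ) (hs : 0 ≤ s) (hb : b + 1 / 2 < s)
    (χ : 𝓢(Vel d, ℂ)) :
    ∃ C : ℝ≥0∞, C < ⊤ ∧ ∀ {g : Vel d → ℝ} (hg : MemLp g 2 volume)
      (h : Lp ℂ 2 (volume : Measure (Vel d))),
      Represents r s hg h →
      ∀ e : Vel d, ‖e‖ = 1 →
        ∫⁻ t : ℝ, ENNReal.ofReal ((1 + ‖t‖) ^ b) * ‖𝓕 (fun v => χ v * (g v : ℂ)) (t • e)‖ₑ ≤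
          C * ‖h‖ₑ := by
  obtain ⟨C, hC, hCb⟩ := exists_lintegral_enorm_fourier_sq_le r s hs χ
  let D : ℝ≥0∞ := ∫⁻ t : ℝ, decay (2 * (s - b)) t
  have hD : D < ⊤ := lintegral_decay_lt_top volume (by
    simp only [Module.finrank_self, Nat.cast_one]; linarith)
  let A : ℝ≥0∞ := ENNReal.ofReal (2 ^ (s / 2))
  have hCD : D * C < ⊤ := ENNReal.mul_lt_top hD hC
  refine ⟨A * (D * C) ^ (1 / 2 : ℝ), ENNReal.mul_lt_top (by simp [A])
    (ENNReal.rpow_lt_top_of_nonneg (by norm_num) hCD.ne), fun {g} hg h hh e he => ?_⟩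
  have hcont : Continuous (𝓕 (fun v => χ v * (g v : ℂ))) :=
    continuous_fourier_of_integrable (MemLp.integrable_schwartz_mul hg χ)
  set Φ : Vel d → ℂ := 𝓕 (fun v => χ v * (g v : ℂ))
  have hmb : Measurable fun t : ℝ => ENNReal.ofReal (bracketSymbol s (t • e)) * ‖Φ (t • e)‖ₑ := by
    have h1 : Continuous (bracketSymbol (d := d) s) :=
      (hasTemperateGrowth_bracketSymbol s).1.continuous
    refine Measurable.mul (M := ℝ≥0∞) ?_ ?_
    · exact (ENNReal.continuous_ofReal.comp (h1.comp (by fun_prop))).measurable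
    · exact (hcont.comp (by fun_prop)).measurable.enorm
  have hle : ∀ t : ℝ, ENNReal.ofReal ((1 + ‖t‖) ^ b) * ‖Φ (t • e)‖ₑ ≤
      A * (decay (s - b) t * (ENNReal.ofReal (bracketSymbol s (t • e)) * ‖Φ (t • e)‖ₑ)) := by
    intro t
    rw [← mul_assoc, ← mul_assoc]
    refine mul_le_mul_left ?_ _
    unfold decay
    rw [← ENNReal.ofReal_mul (by positivity), ← ENNReal.ofReal_mul (by positivity)]
    refine ENNReal.ofReal_le_ofReal ?_
    have h1 : (1 + ‖t‖) ^ b = (1 + ‖t‖) ^ (-(s - b)) * (1 + ‖t‖) ^ s := by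
      rw [← Real.rpow_add (by positivity)]; congr 1; ring
    rw [h1, mul_comm (2 ^ (s / 2) : ℝ), mul_assoc]
    gcongr
    exact one_add_abs_rpow_le_bracketSymbol s hs t he
  have hsq : (∫⁻ t : ℝ, decay (s - b) t *
      (ENNReal.ofReal (bracketSymbol s (t • e)) * ‖Φ (t • e)‖ₑ)) ^ 2 ≤ (D * C) * ‖h‖ₑ ^ 2 := by
    refine (sq_lintegral_mul_le _ (measurable_decay _).aemeasurable hmb.aemeasurable).trans ?_
    simp only [decay_sq]
    rw [mul_assoc]
    exact mul_le_mul_right ((hCb hg h hh).2 e he) _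
  calc _ ≤ ∫⁻ t : ℝ, A * (decay (s - b) t *
      (ENNReal.ofReal (bracketSymbol s (t • e)) * ‖Φ (t • e)‖ₑ)) := lintegral_mono hle
    _ = A * ∫⁻ t : ℝ, decay (s - b) t *
      (ENNReal.ofReal (bracketSymbol s (t • e)) * ‖Φ (t • e)‖ₑ) :=
        lintegral_const_mul' _ _ (by simp [A])
    _ ≤ A * ((D * C) ^ (1 / 2 : ℝ) * ‖h‖ₑ) := by
        gcongr
        have h3 := ENNReal.rpow_le_rpow hsq (z := 1 / 2) (by norm_num)
        rw [ENNReal.mul_rpow_of_nonneg _ _ (by norm_num)] at h3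
        simp only [← ENNReal.rpow_natCast, ← ENNReal.rpow_mul] at h3
        norm_num at h3
        simpa using h3
    _ = _ := by ring

end LenardBalescu
end

/-! ### Gaussian Schwartz functions and calculus of weak derivatives. -/

noncomputable section
namespace LenardBalescu

variable {d : ℕ}

open FourierTransform SchwartzMap

section GaussianSchwartz

variable {E : Type*} [NormedAddCommGroup E] [InnerProductSpace ℝ E]

theorem one_add_pow_mul_exp_le (b : ℝ) (hb : 0 < b) (M : ℕ) (y : ℝ) (hy : 0 ≤ y) :
    (1 + y) ^ M * Real.exp (-b * y ^ 2) ≤ M.factorial * Real.exp (1 + 1 / (4 * b)) := by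
  have h1 := Real.pow_div_factorial_le_exp (1 + y) (by positivity) M
  rw [div_le_iff₀ (by positivity)] at h1
  have h2 : y - b * y ^ 2 ≤ 1 / (4 * b) := by
    rw [le_div_iff₀ (by positivity)]
    nlinarith [sq_nonneg (2 * b * y - 1)]
  calc _ ≤ Real.exp (1 + y) * M.factorial * Real.exp (-b * y ^ 2) := by gcongr
    _ = M.factorial * Real.exp (1 + y + -b * y ^ 2) := by rw [Real.exp_add (1 + y)]; ring
    _ ≤ _ := mul_le_mul_of_nonneg_left (Real.exp_le_exp.2 (by linarith)) (by positivity)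

variable (E) in
/-- The Gaussian `e^{-b‖x‖²}` as a Schwartz function. -/
def gaussianSchwartz (b : ℝ) (hb : 0 < b) : 𝓢(E, ℝ) where
  toFun x := Real.exp (-b * ‖x‖ ^ 2)
  smooth' := by
    have := contDiff_norm_sq (𝕜 := ℝ) (E := E) (n := ∞)
    fun_prop
  decay' k n := by
    have htg : Function.HasTemperateGrowth (fun x : E => -b * ‖x‖ ^ 2) := by fun_prop
    obtain ⟨l, C, hC, hCb⟩ := htg.norm_iteratedFDeriv_le_uniform n
    refine ⟨n.factorial * (1 + C) ^ n * (((k + l * n).factorial) * Real.exp (1 + 1 / (4 * b))),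
      fun x => ?_⟩
    -- Every derivative of `exp` at `-b‖x‖²` is the Gaussian itself, so differentiation only creates
    -- polynomial factors.
    have h1 := norm_iteratedFDeriv_comp_le (n := n) (N := ∞) (g := Real.exp)
      (f := fun x : E => -b * ‖x‖ ^ 2) Real.contDiff_exp htg.1 (by exact_mod_cast le_top) x
      (C := Real.exp (-b * ‖x‖ ^ 2)) (D := (1 + C) * (1 + ‖x‖) ^ l)
      (by
        intro i _
        rw [norm_iteratedFDeriv_eq_norm_iteratedDeriv, iteratedDeriv_eq_iterate, Real.iter_deriv_exp,
          Real.norm_of_nonneg (Real.exp_nonneg _)])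
      (by
        intro i hi hin
        refine (hCb i hin x).trans ?_
        have h2 : (1 : ℝ) ≤ (1 + ‖x‖) ^ l := one_le_pow₀ (by simp)
        calc C * (1 + ‖x‖) ^ l ≤ (1 + C) * (1 + ‖x‖) ^ l := by gcongr; linarith
          _ ≤ _ := le_self_pow₀ (one_le_mul_of_one_le_of_one_le (by linarith) h2) (by omega))
    calc _ ≤ ‖x‖ ^ k * (n.factorial * Real.exp (-b * ‖x‖ ^ 2) * ((1 + C) * (1 + ‖x‖) ^ l) ^ n) := by
          gcongr; exact h1
      _ ≤ (1 + ‖x‖) ^ k *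
          (n.factorial * Real.exp (-b * ‖x‖ ^ 2) * ((1 + C) * (1 + ‖x‖) ^ l) ^ n) := by
          gcongr; simp
      _ = n.factorial * (1 + C) ^ n * ((1 + ‖x‖) ^ (k + l * n) * Real.exp (-b * ‖x‖ ^ 2)) := by
          rw [mul_pow, pow_add, pow_mul]; ring
      _ ≤ _ := by
          exact mul_le_mul_of_nonneg_left (one_add_pow_mul_exp_le b hb _ _ (norm_nonneg x))
            (by positivity)

theorem gaussianSchwartz_apply (b : ℝ) (hb : 0 < b) (x : E) :
    gaussianSchwartz E b hb x = Real.exp (-b * ‖x‖ ^ 2) := rfl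

end GaussianSchwartz

/-- `D` is the weak directional derivative of `F` along `m`. -/
def IsWeakDeriv (m : Vel d) (F D : Vel d → ℝ) : Prop :=
  ∀ θ : Vel d → ℝ, ContDiff ℝ ∞ θ → HasCompactSupport θ →
    ∫ v, F v * fderiv ℝ θ v m = -∫ v, θ v * D v

theorem integrable_mul_test {F θ : Vel d → ℝ} (hF : LocallyIntegrable F) (hθ : Continuous θ)
    (hc : HasCompactSupport θ) : Integrable fun v => F v * θ v := by
  simpa [mul_comm] using hF.integrable_smul_left_of_hasCompactSupport hθ hc

/-- The product rule follows by testing the weak derivative of `F` against `q θ`. -/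
theorem IsWeakDeriv.smooth_mul {m : Vel d} {F D q : Vel d → ℝ} (h : IsWeakDeriv m F D)
    (hF : LocallyIntegrable F) (hD : LocallyIntegrable D) (hq : ContDiff ℝ ∞ q) :
    IsWeakDeriv m (fun v => q v * F v) (fun v => q v * D v + F v * fderiv ℝ q v m) := by
  intro θ hθ hc
  have h1 := h (fun v => q v * θ v) (hq.mul hθ) hc.mul_left
  have hfd : ∀ v, fderiv ℝ (fun v => q v * θ v) v m =
      q v * fderiv ℝ θ v m + θ v * fderiv ℝ q v m := by
    intro v
    rw [fderiv_fun_mul (hq.differentiable (by simp) v) (hθ.differentiable (by simp) v)]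
    simp
  have hcq : Continuous fun v => fderiv ℝ q v m :=
    (hq.continuous_fderiv (by simp)).clm_apply continuous_const
  have hcθ : Continuous fun v => fderiv ℝ θ v m :=
    (hθ.continuous_fderiv (by simp)).clm_apply continuous_const
  have hsθ : HasCompactSupport fun v => fderiv ℝ θ v m := hc.fderiv_apply (𝕜 := ℝ) m
  have i1 : Integrable fun v => F v * (q v * fderiv ℝ θ v m) :=
    integrable_mul_test hF (hq.continuous.mul hcθ) hsθ.mul_left
  have i2 : Integrable fun v => F v * (θ v * fderiv ℝ q v m) :=
    integrable_mul_test hF (hθ.continuous.mul hcq) hc.mul_right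
  have i3 : Integrable fun v => D v * (q v * θ v) :=
    integrable_mul_test hD (hq.continuous.mul hθ.continuous) hc.mul_left
  simp only [hfd, mul_add] at h1
  rw [integral_add i1 i2] at h1
  have e1 : ∫ v, q v * F v * fderiv ℝ θ v m = ∫ v, F v * (q v * fderiv ℝ θ v m) := by
    congr with v; ring
  have e2 : ∫ v, θ v * (q v * D v + F v * fderiv ℝ q v m) =
      (∫ v, q v * θ v * D v) + ∫ v, F v * (θ v * fderiv ℝ q v m) := by
    rw [← integral_add (by simpa [mul_comm] using i3) i2]
    congr with v; ring
  rw [e1, e2]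
  linarith

theorem isWeakDeriv_of_contDiff (m : Vel d) {q : Vel d → ℝ} (hq : ContDiff ℝ ∞ q) :
    IsWeakDeriv m q (fun v => fderiv ℝ q v m) := by
  intro θ hθ hc
  have hcq : Continuous fun v => fderiv ℝ q v m :=
    (hq.continuous_fderiv (by simp)).clm_apply continuous_const
  have hcθ : Continuous fun v => fderiv ℝ θ v m :=
    (hθ.continuous_fderiv (by simp)).clm_apply continuous_const
  have hsθ : HasCompactSupport fun v => fderiv ℝ θ v m := hc.fderiv_apply (𝕜 := ℝ) m
  have := integral_mul_fderiv_eq_neg_fderiv_mul_of_integrable (μ := (volume : Measure (Vel d)))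
    (f := q) (g := θ) (v := m)
    ((hcq.mul hθ.continuous).integrable_of_hasCompactSupport hc.mul_left)
    ((hq.continuous.mul hcθ).integrable_of_hasCompactSupport hsθ.mul_left)
    ((hq.continuous.mul hθ.continuous).integrable_of_hasCompactSupport hc.mul_left)
    (fun x _ => hq.differentiable (by simp) x) (fun x _ => hθ.differentiable (by simp) x)
  rw [this]
  congr 2 with v
  ring

theorem IsWeakDeriv.add {m : Vel d} {F D F' D' : Vel d → ℝ} (h : IsWeakDeriv m F D)
    (h' : IsWeakDeriv m F' D') (hF : LocallyIntegrable F) (hD : LocallyIntegrable D)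
    (hF' : LocallyIntegrable F') (hD' : LocallyIntegrable D') :
    IsWeakDeriv m (fun v => F v + F' v) (fun v => D v + D' v) := by
  intro θ hθ hc
  have hcθ : Continuous fun v => fderiv ℝ θ v m :=
    (hθ.continuous_fderiv (by simp)).clm_apply continuous_const
  have hsθ : HasCompactSupport fun v => fderiv ℝ θ v m := hc.fderiv_apply (𝕜 := ℝ) m
  simp only [add_mul, mul_add]
  rw [integral_add (integrable_mul_test hF hcθ hsθ) (integrable_mul_test hF' hcθ hsθ),
    integral_add (by simpa [mul_comm] using integrable_mul_test hD hθ.continuous hc)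
      (by simpa [mul_comm] using integrable_mul_test hD' hθ.continuous hc), h θ hθ hc, h' θ hθ hc]
  ring

theorem inner_gradient_eq_fderiv (θ : Vel d → ℝ) (v k : Vel d) :
    inner ℝ k (gradient θ v) = fderiv ℝ θ v k := by
  unfold gradient
  rw [real_inner_comm, InnerProductSpace.toDual_symm_apply]

/-- Componentwise criterion for weak gradients. -/
theorem exists_isWeakGradient {F : Vel d → ℝ} {D : Fin d → Vel d → ℝ} (hF : Integrable F)
    (hD : ∀ j, Integrable (D j))
    (h : ∀ j, IsWeakDeriv (EuclideanSpace.single j 1) F (D j)) :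
    ∃ G, IsWeakGradient F G ∧ Integrable G := by
  let G : Vel d → Vel d := fun v => ∑ j, D j v • EuclideanSpace.single j (1 : ℝ)
  have hG : Integrable G := integrable_finsetSum _ fun j _ => (hD j).smul_const _
  refine ⟨G, ⟨hF.locallyIntegrable, hG.locallyIntegrable, fun θ hθ hc => ?_⟩, hG⟩
  have hcg : Continuous (gradient θ) := by
    have : gradient θ = fun v => (InnerProductSpace.toDual ℝ (Vel d)).symm (fderiv ℝ θ v) := rfl
    rw [this]
    exact (LinearIsometryEquiv.continuous _).comp (hθ.continuous_fderiv (by simp))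
  have hsg : HasCompactSupport (gradient θ) := by
    have : gradient θ = fun v => (InnerProductSpace.toDual ℝ (Vel d)).symm (fderiv ℝ θ v) := rfl
    rw [this]
    exact (hc.fderiv (𝕜 := ℝ)).comp_left (g := (InnerProductSpace.toDual ℝ (Vel d)).symm)
      (map_zero _)
  have i1 : Integrable fun v => F v • gradient θ v :=
    hF.locallyIntegrable.integrable_smul_right_of_hasCompactSupport hcg hsg
  have i2 : Integrable fun v => θ v • G v :=
    hG.locallyIntegrable.integrable_smul_left_of_hasCompactSupport hθ.continuous hc
  ext j
  have hj := h j θ hθ hc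
  have e1 : (∫ v, F v • gradient θ v) j = ∫ v, F v * fderiv ℝ θ v (EuclideanSpace.single j 1) := by
    refine ((EuclideanSpace.proj (𝕜 := ℝ) j : Vel d →L[ℝ] ℝ).integral_comp_comm i1).symm.trans ?_
    congr with v
    have hin : gradient θ v j = fderiv ℝ θ v (EuclideanSpace.single j 1) := by
      rw [← inner_gradient_eq_fderiv, EuclideanSpace.inner_single_left]
      simp
    simp [hin]
  have e2 : (∫ v, θ v • G v) j = ∫ v, θ v * D j v := by
    refine ((EuclideanSpace.proj (𝕜 := ℝ) j : Vel d →L[ℝ] ℝ).integral_comp_comm i2).symm.trans ?_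
    congr with v
    simp [G]
  rw [e1, PiLp.neg_apply, e2, hj]

theorem IsWeakGradient.ae_eq {F : Vel d → ℝ} {G G' : Vel d → Vel d} (h : IsWeakGradient F G)
    (h' : IsWeakGradient F G') : G =ᵐ[volume] G' := by
  refine ae_eq_of_integral_contDiff_smul_eq h.2.1 h'.2.1 fun θ hθ hc => ?_
  rw [← neg_inj, ← h.2.2 θ hθ hc, h'.2.2 θ hθ hc]

theorem isWeakGradient_weakGradient {F : Vel d → ℝ} (h : ∃ G, IsWeakGradient F G) :
    IsWeakGradient F (weakGradient F) := by
  unfold weakGradient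
  rw [dif_pos h]
  exact h.choose_spec

theorem integrable_weakGradient {F : Vel d → ℝ} (h : ∃ G, IsWeakGradient F G ∧ Integrable G) :
    Integrable (weakGradient F) := by
  obtain ⟨G, hG, hi⟩ := h
  exact hi.congr (hG.ae_eq (isWeakGradient_weakGradient ⟨G, hG⟩))

/-- The defining identity of weak gradients extends to smooth test functions bounded with their
first derivatives, if the function and its weak gradient are integrable. -/
theorem IsWeakGradient.integral_mul_fderiv {F : Vel d → ℝ} {G : Vel d → Vel d}
    (h : IsWeakGradient F G) (hF : Integrable F) (hG : Integrable G) {ρ : Vel d → ℝ}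
    (hρ : ContDiff ℝ ∞ ρ) {A B : ℝ} (hA : ∀ v, |ρ v| ≤ A) (hB : ∀ v, ‖fderiv ℝ ρ v‖ ≤ B)
    (k : Vel d) : ∫ v, F v * fderiv ℝ ρ v k = -∫ v, ρ v * inner ℝ k (G v) := by
  let χ : ContDiffBump (0 : Vel d) := ⟨1, 2, by norm_num, by norm_num⟩
  have hχ : ContDiff ℝ ∞ χ := χ.contDiff
  have hχfc : Continuous (fderiv ℝ χ) := hχ.continuous_fderiv (by simp)
  obtain ⟨M, hM⟩ := (χ.hasCompactSupport.fderiv (𝕜 := ℝ)).exists_bound_of_continuous hχfc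
  have hM0 : 0 ≤ M := (norm_nonneg _).trans (hM 0)
  have hA0 : 0 ≤ A := (abs_nonneg _).trans (hA 0)
  have hB0 : 0 ≤ B := (norm_nonneg _).trans (hB 0)
  -- The cut-offs `χ (a n • v)` tend to 1 and their gradients are `O(a n)`. Integrability of `F` and
  -- `G` then permits dominated convergence on both sides.
  let a : ℕ → ℝ := fun n => ((n : ℝ) + 1)⁻¹
  have ha0 : ∀ n, 0 < a n := fun n => by positivity
  have ha1 : ∀ n, a n ≤ 1 := fun n => inv_le_one_of_one_le₀ (by simp)
  have hat : Tendsto a atTop (𝓝 0) := by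
    simpa [a, one_div] using tendsto_one_div_add_atTop_nhds_zero_nat (𝕜 := ℝ)
  let χn : ℕ → Vel d → ℝ := fun n v => χ (a n • v)
  have hχn : ∀ n, ContDiff ℝ ∞ (χn n) := fun n => hχ.comp (contDiff_id.const_smul (a n))
  have hχns : ∀ n, HasCompactSupport (χn n) := fun n =>
    χ.hasCompactSupport.comp_smul (ha0 n).ne'
  have hχfd : ∀ n v, fderiv ℝ (χn n) v k = a n * fderiv ℝ χ (a n • v) k := by
    intro n v
    have : HasFDerivAt (χn n) ((fderiv ℝ χ (a n • v)).comp (a n • ContinuousLinearMap.id ℝ (Vel d))) v :=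
      ((hχ.differentiable (by simp) _).hasFDerivAt).comp v ((a n • ContinuousLinearMap.id ℝ (Vel d)).hasFDerivAt)
    rw [this.fderiv]
    simp
  have hχb : ∀ v, |χ v| ≤ 1 := fun v => by
    rw [abs_of_nonneg χ.nonneg]; exact χ.le_one
  have hlim : ∀ v : Vel d, Tendsto (fun n => a n • v) atTop (𝓝 0) := fun v => by
    have h1 : Tendsto (fun n => a n • v) atTop (𝓝 ((0 : ℝ) • v)) := Tendsto.smul hat tendsto_const_nhds
    rwa [zero_smul] at h1
  have hlimχ : ∀ v, Tendsto (fun n => χn n v) atTop (𝓝 1) := fun v => by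
    have := (hχ.continuous.tendsto 0).comp (hlim v)
    have h1 : χ 0 = 1 := χ.one_of_mem_closedBall (by simp [χ])
    rwa [h1] at this
  have hlimfd : ∀ v, Tendsto (fun n => fderiv ℝ (χn n) v k) atTop (𝓝 0) := fun v => by
    simp only [hχfd]
    have := hat.mul (((hχfc.clm_apply continuous_const (g := fun _ => k)).tendsto 0).comp (hlim v))
    simpa using this
  have hfd : ∀ n v, fderiv ℝ (fun v => χn n v * ρ v) v k =
      χn n v * fderiv ℝ ρ v k + ρ v * fderiv ℝ (χn n) v k := by
    intro n v
    rw [fderiv_fun_mul ((hχn n).differentiable (by simp) v) (hρ.differentiable (by simp) v)]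
    simp
  have hρk : Continuous fun v => fderiv ℝ ρ v k :=
    (hρ.continuous_fderiv (by simp)).clm_apply continuous_const
  have hχk : ∀ n, Continuous fun v => fderiv ℝ (χn n) v k := fun n =>
    ((hχn n).continuous_fderiv (by simp)).clm_apply continuous_const
  have heq : ∀ n, ∫ v, F v * (χn n v * fderiv ℝ ρ v k + ρ v * fderiv ℝ (χn n) v k) =
      -∫ v, (χn n v * ρ v) * inner ℝ k (G v) := by
    intro n
    have hθ : ContDiff ℝ ∞ fun v => χn n v * ρ v := (hχn n).mul hρ
    have hc : HasCompactSupport fun v => χn n v * ρ v := (hχns n).mul_right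
    have h1 := congrArg (fun w => inner ℝ k w) (h.2.2 _ hθ hc)
    have hcg : Continuous (gradient fun v => χn n v * ρ v) :=
      (LinearIsometryEquiv.continuous (InnerProductSpace.toDual ℝ (Vel d)).symm).comp
        (hθ.continuous_fderiv (by simp))
    have hsg : HasCompactSupport (gradient fun v => χn n v * ρ v) :=
      (hc.fderiv (𝕜 := ℝ)).comp_left (g := (InnerProductSpace.toDual ℝ (Vel d)).symm) (map_zero _)
    have i1 : Integrable fun v => F v • gradient (fun v => χn n v * ρ v) v :=
      hF.locallyIntegrable.integrable_smul_right_of_hasCompactSupport hcg hsg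
    have i2 : Integrable fun v => (χn n v * ρ v) • G v :=
      hG.locallyIntegrable.integrable_smul_left_of_hasCompactSupport hθ.continuous hc
    simp only [inner_neg_right] at h1
    rw [← integral_inner i1, ← integral_inner i2] at h1
    simp only [inner_smul_right, inner_gradient_eq_fderiv, hfd] at h1
    exact h1
  have hGk : Integrable fun v => inner ℝ k (G v) := hG.const_inner k
  have L1 : Tendsto (fun n => ∫ v, F v * (χn n v * fderiv ℝ ρ v k + ρ v * fderiv ℝ (χn n) v k))
      atTop (𝓝 (∫ v, F v * fderiv ℝ ρ v k)) := by
    refine tendsto_integral_of_dominated_convergence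
      (fun v => ‖F v‖ * (B * ‖k‖ + A * (M * ‖k‖))) (fun n => ?_) (hF.norm.mul_const _) (fun n => ?_) ?_
    · exact hF.aestronglyMeasurable.mul
        ((((hχn n).continuous.mul hρk).add (hρ.continuous.mul (hχk n))).aestronglyMeasurable)
    · refine Eventually.of_forall fun v => ?_
      rw [norm_mul]
      refine mul_le_mul_of_nonneg_left ?_ (norm_nonneg _)
      refine (norm_add_le _ _).trans (add_le_add ?_ ?_)
      · rw [norm_mul]
        calc _ ≤ 1 * (B * ‖k‖) := by
              gcongr
              · exact hχb _
              · exact (fderiv ℝ ρ v).le_of_opNorm_le (hB v) k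
          _ = _ := one_mul _
      · rw [norm_mul]
        gcongr
        · exact hA v
        · rw [hχfd, norm_mul, Real.norm_of_nonneg (ha0 n).le]
          calc _ ≤ 1 * (M * ‖k‖) := by
                gcongr
                · exact ha1 n
                · exact (fderiv ℝ χ _).le_of_opNorm_le (hM _) k
            _ = _ := one_mul _
    · refine Eventually.of_forall fun v => ?_
      have := (((hlimχ v).mul_const (fderiv ℝ ρ v k)).add ((hlimfd v).const_mul (ρ v))).const_mul (F v)
      simpa using this
  have L2 : Tendsto (fun n => -∫ v, (χn n v * ρ v) * inner ℝ k (G v))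
      atTop (𝓝 (-∫ v, ρ v * inner ℝ k (G v))) := by
    refine (tendsto_integral_of_dominated_convergence
      (fun v => A * ‖inner ℝ k (G v)‖) (fun n => ?_) (hGk.norm.const_mul _) (fun n => ?_) ?_).neg
    · exact ((hχn n).continuous.mul hρ.continuous).aestronglyMeasurable.mul hGk.aestronglyMeasurable
    · refine Eventually.of_forall fun v => ?_
      rw [norm_mul, norm_mul]
      gcongr
      calc _ ≤ 1 * A := by
            gcongr
            · exact hχb _
            · exact hA v
        _ = A := one_mul _
    · refine Eventually.of_forall fun v => ?_
      have := ((hlimχ v).mul_const (ρ v)).mul_const (inner ℝ k (G v))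
      simpa using this
  simp only [heq] at L1
  exact tendsto_nhds_unique L1 L2

end LenardBalescu
end

/-! ### The weak gradient of the perturbed density and its Fourier transform. -/

noncomputable section
namespace LenardBalescu

variable {d : ℕ}

open FourierTransform SchwartzMap

/-- The complexification of a real Schwartz function. -/
def complexify (q : 𝓢(Vel d, ℝ)) : 𝓢(Vel d, ℂ) := q.postcompCLM Complex.ofRealCLM

theorem complexify_apply (q : 𝓢(Vel d, ℝ)) (v : Vel d) : complexify q v = (q v : ℂ) := rfl

theorem integral_fourier_mul_schwartz {f : Vel d → ℂ} (hf : Integrable f) (ψ : 𝓢(Vel d, ℂ)) :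
    ∫ ζ, 𝓕 f ζ * ψ ζ = ∫ v, f v * 𝓕 ψ v :=
  VectorFourier.integral_fourierIntegral_smul_eq_flip (L := innerₗ (Vel d))
    Real.continuous_fourierChar continuous_inner hf ψ.integrable |>.trans (by
      congr with v
      rw [fourier_coe]
      simp only [smul_eq_mul]
      congr 1
      rw [Real.fourier_eq]
      simp [VectorFourier.fourierIntegral])

theorem norm_two_pi_smul_le_bracketSymbol (s : ℝ) (hs : 1 ≤ s) (ζ : Vel d) :
    2 * Real.pi * ‖ζ‖ ≤ bracketSymbol s ζ := by
  have h1 : 2 * Real.pi * ‖ζ‖ = ‖(2 * Real.pi) • ζ‖ := by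
    rw [norm_smul, Real.norm_of_nonneg (by positivity)]
  rw [h1]
  unfold bracketSymbol
  set y := ‖(2 * Real.pi) • ζ‖
  have hy : 0 ≤ y := norm_nonneg _
  calc y = (y ^ 2) ^ (1 / 2 : ℝ) := by
        rw [← Real.rpow_natCast, ← Real.rpow_mul hy]; norm_num
    _ ≤ (1 + y ^ 2) ^ (1 / 2 : ℝ) := Real.rpow_le_rpow (by positivity) (by linarith) (by norm_num)
    _ ≤ _ := Real.rpow_le_rpow_of_exponent_le (by nlinarith) (by linarith)

/-- On the Fourier side the derivative is multiplication by `2πi ζ·m`. Since `2π‖ζ‖ ≤ ⟨2πζ⟩^s` for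
`s ≥ 1`, the weighted bound on `ℝ^d` puts the product in `L²`, and its inverse transform is the weak
derivative. -/
theorem exists_weakDeriv_schwartz_mul (r s : ℝ) (hs : 1 ≤ s) (q : 𝓢(Vel d, ℝ)) {g : Vel d → ℝ}
    (hg : MemLp g 2 volume) (h : Lp ℂ 2 (volume : Measure (Vel d))) (hh : Represents r s hg h)
    (m : Vel d) :
    ∃ D : Vel d → ℝ, MemLp D 2 volume ∧ IsWeakDeriv m (fun v => q v * g v) D := by
  obtain ⟨C, hC, hCb⟩ := exists_lintegral_enorm_fourier_sq_le r s (by linarith) (complexify q)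
  have hfi := MemLp.integrable_schwartz_mul hg (complexify q)
  have hL := (hCb hg h hh).1
  set f : Vel d → ℂ := fun v => complexify q v * (g v : ℂ) with hf
  have hcont : Continuous (𝓕 f) := continuous_fourier_of_integrable hfi
  let K : Vel d → ℂ := fun ζ => (2 * Real.pi * Complex.I) * (inner ℝ ζ m : ℝ) * 𝓕 f ζ
  have hKc : Continuous K := by
    have : Continuous fun ζ : Vel d => ((inner ℝ ζ m : ℝ) : ℂ) :=
      Complex.continuous_ofReal.comp (by fun_prop)
    fun_prop
  have hKle : ∀ ζ, ‖K ζ‖ₑ ≤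
      ENNReal.ofReal ‖m‖ * (ENNReal.ofReal (bracketSymbol s ζ) * ‖𝓕 f ζ‖ₑ) := by
    intro ζ
    rw [← mul_assoc, ← ENNReal.ofReal_mul (norm_nonneg _), ← ofReal_norm, ← ofReal_norm,
      ← ENNReal.ofReal_mul (mul_nonneg (norm_nonneg _) (bracketSymbol_pos _ _).le)]
    refine ENNReal.ofReal_le_ofReal ?_
    simp only [K, norm_mul, Complex.norm_real, Complex.norm_I, mul_one, Complex.norm_ofNat,
      Real.norm_of_nonneg Real.pi_pos.le]
    refine mul_le_mul_of_nonneg_right ?_ (norm_nonneg _)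
    calc _ ≤ 2 * Real.pi * (‖ζ‖ * ‖m‖) := by gcongr; exact norm_inner_le_norm _ _
      _ = ‖m‖ * (2 * Real.pi * ‖ζ‖) := by ring
      _ ≤ _ := by gcongr; exact norm_two_pi_smul_le_bracketSymbol s hs ζ
  have hK : MemLp K 2 volume := by
    refine ⟨hKc.aestronglyMeasurable, ?_⟩
    rw [eLpNorm_lt_top_iff_lintegral_rpow_enorm_lt_top (by simp) (by simp)]
    calc ∫⁻ ζ, ‖K ζ‖ₑ ^ (2 : ℝ≥0∞).toReal
        ≤ ∫⁻ ζ, ENNReal.ofReal ‖m‖ ^ 2 *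
          (ENNReal.ofReal (bracketSymbol s ζ) * ‖𝓕 f ζ‖ₑ) ^ 2 := by
          refine lintegral_mono fun ζ => ?_
          rw [← mul_pow]
          simp only [ENNReal.toReal_ofNat]
          rw [show (2 : ℝ) = ((2 : ℕ) : ℝ) by norm_num, ENNReal.rpow_natCast]
          gcongr
          exact hKle ζ
      _ = ENNReal.ofReal ‖m‖ ^ 2 *
          ∫⁻ ζ, (ENNReal.ofReal (bracketSymbol s ζ) * ‖𝓕 f ζ‖ₑ) ^ 2 :=
          lintegral_const_mul' _ _ (by simp)
      _ < ⊤ := ENNReal.mul_lt_top (by simp) (hL.trans_lt (ENNReal.mul_lt_top hC (by simp)))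
  let G : Lp ℂ 2 (volume : Measure (Vel d)) := 𝓕⁻ hK.toLp
  -- Only the real part is kept: `q g` and the test functions are real, so taking real parts in the
  -- complex identity suffices.
  refine ⟨fun v => (G v).re, (Lp.memLp G).re, fun θ hθ hc => ?_⟩
  have hg1 : HasCompactSupport (Complex.ofRealCLM ∘ θ) := hc.comp_left rfl
  have hg2 : ContDiff ℝ ∞ (Complex.ofRealCLM ∘ θ) := by fun_prop
  let Θ : 𝓢(Vel d, ℂ) := hg1.toSchwartzMap hg2
  have hΘ : ∀ v, Θ v = (θ v : ℂ) := fun v => rfl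
  have hdΘ : ∀ v, (LineDeriv.lineDerivOp m Θ : 𝓢(Vel d, ℂ)) v = ((fderiv ℝ θ v m : ℝ) : ℂ) := by
    intro v
    rw [lineDerivOp_apply_eq_fderiv]
    have : HasFDerivAt (Θ : Vel d → ℂ) (Complex.ofRealCLM.comp (fderiv ℝ θ v)) v :=
      Complex.ofRealCLM.hasFDerivAt.comp v (hθ.differentiable (by simp) v).hasFDerivAt
    rw [this.fderiv]
    rfl
  have key : ∫ v, f v * (LineDeriv.lineDerivOp m Θ : 𝓢(Vel d, ℂ)) v = -∫ v, Θ v * G v := by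
    have e1 : ∫ v, f v * (LineDeriv.lineDerivOp m Θ : 𝓢(Vel d, ℂ)) v =
        ∫ ζ, 𝓕 f ζ * (𝓕⁻ (LineDeriv.lineDerivOp m Θ : 𝓢(Vel d, ℂ))) ζ := by
      rw [integral_fourier_mul_schwartz hfi, fourier_fourierInv_eq]
    have e2 : ∫ v, Θ v * G v = ∫ ζ, (𝓕⁻ Θ) ζ * K ζ := by
      have h1 := DFunLike.congr_fun (Lp.fourierInv_toTemperedDistribution_eq hK.toLp) Θ
      rw [TemperedDistribution.fourierInv_apply, Lp.toTemperedDistribution_apply,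
        Lp.toTemperedDistribution_apply] at h1
      simp only [smul_eq_mul] at h1
      rw [← h1]
      refine integral_congr_ae ?_
      filter_upwards [hK.coeFn_toLp] with ζ hζ
      rw [hζ]
    rw [e1, e2, ← integral_neg]
    congr with ζ
    rw [fourierInv_lineDerivOp_eq, _root_.smul_apply, smulLeftCLM_apply_apply (by fun_prop)]
    simp only [K, smul_eq_mul, Complex.real_smul]
    ring
  have hre := congrArg Complex.re key
  have hi1 : Integrable fun v => f v * (LineDeriv.lineDerivOp m Θ : 𝓢(Vel d, ℂ)) v := by
    have := hfi.mul_of_top_right ((LineDeriv.lineDerivOp m Θ : 𝓢(Vel d, ℂ)).memLp_top volume)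
    exact this.congr (Eventually.of_forall fun v => mul_comm _ _)
  have hi2 : Integrable fun v => Θ v * G v := (Θ.memLp 2).integrable_mul (Lp.memLp G)
  have r1 : (∫ v, f v * (LineDeriv.lineDerivOp m Θ : 𝓢(Vel d, ℂ)) v).re =
      ∫ v, q v * g v * fderiv ℝ θ v m := by
    have := integral_re (𝕜 := ℂ) hi1
    refine this.symm.trans ?_
    congr with v
    simp only [hdΘ, hf, complexify_apply, ← Complex.ofReal_mul]
    rfl
  have r2 : (∫ v, Θ v * G v).re = ∫ v, θ v * (G v).re := by
    have := integral_re (𝕜 := ℂ) hi2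
    refine this.symm.trans ?_
    congr with v
    rw [hΘ]
    exact Complex.re_ofReal_mul _ _
  rw [Complex.neg_re, r1, r2] at hre
  exact hre

/-- The Schwartz function `μ^{1/4}`. -/
def quarterMaxwellian (d : ℕ) : 𝓢(Vel d, ℝ) :=
  ((1 / Real.pi) ^ ((d : ℝ) / 8) : ℝ) • gaussianSchwartz (Vel d) (1 / 4) (by norm_num)

/-- The Schwartz function `√μ`. -/
def sqrtMaxwellian (d : ℕ) : 𝓢(Vel d, ℝ) :=
  ((1 / Real.pi) ^ ((d : ℝ) / 4) : ℝ) • gaussianSchwartz (Vel d) (1 / 2) (by norm_num)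

/-- The Schwartz function `μ`. -/
def maxwellianSchwartz (d : ℕ) : 𝓢(Vel d, ℝ) :=
  ((1 / Real.pi) ^ ((d : ℝ) / 2) : ℝ) • gaussianSchwartz (Vel d) 1 one_pos

theorem maxwellianSchwartz_apply (v : Vel d) : maxwellianSchwartz d v = maxwellian v := by
  simp [maxwellianSchwartz, maxwellian, gaussianSchwartz_apply]

theorem sqrtMaxwellian_apply (v : Vel d) : sqrtMaxwellian d v = Real.sqrt (maxwellian v) := by
  symm
  rw [Real.sqrt_eq_iff_mul_self_eq_of_pos (by simp [sqrtMaxwellian, gaussianSchwartz_apply]; positivity)]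
  simp only [sqrtMaxwellian, _root_.smul_apply, gaussianSchwartz_apply, smul_eq_mul, maxwellian]
  rw [mul_mul_mul_comm, ← Real.exp_add, ← Real.rpow_add (by positivity)]
  congr 2 <;> ring

theorem quarterMaxwellian_mul_self (v : Vel d) :
    quarterMaxwellian d v * quarterMaxwellian d v = Real.sqrt (maxwellian v) := by
  rw [← sqrtMaxwellian_apply]
  simp only [sqrtMaxwellian, quarterMaxwellian, _root_.smul_apply, gaussianSchwartz_apply,
    smul_eq_mul]
  rw [mul_mul_mul_comm, ← Real.exp_add, ← Real.rpow_add (by positivity)]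
  congr 2 <;> ring

theorem integrable_fderiv_schwartz (q : 𝓢(Vel d, ℝ)) (m : Vel d) :
    Integrable fun v => fderiv ℝ q v m := by
  have := (LineDeriv.lineDerivOp m q : 𝓢(Vel d, ℝ)).integrable (μ := volume)
  exact this.congr (Eventually.of_forall fun v => lineDerivOp_apply_eq_fderiv m q v)

theorem integrable_maxwellian : Integrable (maxwellian (d := d)) :=
  (maxwellianSchwartz d).integrable.congr (Eventually.of_forall maxwellianSchwartz_apply)

theorem isWeakDeriv_maxwellian (m : Vel d) :
    IsWeakDeriv m maxwellian (fun v => fderiv ℝ (maxwellianSchwartz d) v m) := by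
  have h := isWeakDeriv_of_contDiff m ((maxwellianSchwartz d).smooth ⊤)
  have h2 : (maxwellianSchwartz d : Vel d → ℝ) = maxwellian := funext maxwellianSchwartz_apply
  exact (congrArg (fun q => IsWeakDeriv m q fun v => fderiv ℝ (maxwellianSchwartz d) v m) h2).mp h

theorem exists_isWeakGradient_maxwellian :
    ∃ G, IsWeakGradient (maxwellian (d := d)) G ∧ Integrable G :=
  exists_isWeakGradient integrable_maxwellian (fun _ => integrable_fderiv_schwartz _ _)
    fun _ => isWeakDeriv_maxwellian _

theorem integrable_sqrtMaxwellian_mul {g : Vel d → ℝ} (hg : MemLp g 2 volume) :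
    Integrable fun v => Real.sqrt (maxwellian v) * g v := by
  simp only [← sqrtMaxwellian_apply]
  exact ((sqrtMaxwellian d).memLp 2).integrable_mul hg

theorem integrable_perturbed {g : Vel d → ℝ} (hg : MemLp g 2 volume) :
    Integrable (perturbed g) :=
  integrable_maxwellian.add (integrable_sqrtMaxwellian_mul hg)

/-- Write `√μ g = Q (Q g)` with `Q = μ^{1/4}`. The inner factor gives a weak derivative in `L²`, and
the outer one makes it integrable by Cauchy–Schwarz. -/
theorem exists_isWeakGradient_perturbed (r s : ℝ) (hs : 1 ≤ s) {g : Vel d → ℝ}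
    (hg : MemLp g 2 volume) (h : Lp ℂ 2 (volume : Measure (Vel d))) (hh : Represents r s hg h) :
    ∃ G, IsWeakGradient (perturbed g) G ∧ Integrable G := by
  let Q := quarterMaxwellian d
  have hQ : ContDiff ℝ ∞ Q := Q.smooth ⊤
  have hQg : Integrable fun v => Q v * g v := (Q.memLp 2).integrable_mul hg
  have hex := fun j : Fin d =>
    exists_weakDeriv_schwartz_mul r s hs Q hg h hh (EuclideanSpace.single j 1)
  choose D hD hDw using hex
  have hD' : ∀ j, Integrable fun v => Q v * D j v := fun j => (Q.memLp 2).integrable_mul (hD j)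
  have hF' : ∀ j : Fin d, Integrable fun v =>
      Q v * g v * fderiv ℝ Q v (EuclideanSpace.single j 1) := by
    intro j
    have := hQg.mul_of_top_left
      ((LineDeriv.lineDerivOp (EuclideanSpace.single j (1 : ℝ)) Q : 𝓢(Vel d, ℝ)).memLp_top volume)
    exact this
  have hsq : (fun v => Q v * (Q v * g v)) = fun v => Real.sqrt (maxwellian v) * g v := by
    ext v
    rw [← mul_assoc, quarterMaxwellian_mul_self]
  have hw : ∀ j : Fin d, IsWeakDeriv (EuclideanSpace.single j 1)
      (fun v => Real.sqrt (maxwellian v) * g v)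
      (fun v => Q v * D j v + Q v * g v * fderiv ℝ Q v (EuclideanSpace.single j 1)) := by
    intro j
    rw [← hsq]
    exact (hDw j).smooth_mul hQg.locallyIntegrable ((hD j).locallyIntegrable (by norm_num)) hQ
  refine exists_isWeakGradient (integrable_perturbed hg)
    (fun j => (integrable_fderiv_schwartz (maxwellianSchwartz d) (EuclideanSpace.single j 1)).add
      ((hD' j).add (hF' j))) fun j => ?_
  exact (isWeakDeriv_maxwellian _).add (hw j) integrable_maxwellian.locallyIntegrable
    (integrable_fderiv_schwartz _ _).locallyIntegrable
    (integrable_sqrtMaxwellian_mul hg).locallyIntegrable ((hD' j).add (hF' j)).locallyIntegrable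

theorem fourierChar_neg_eq (x : ℝ) : (Real.fourierChar (-x) : ℂ) =
    (Real.cos (2 * Real.pi * x) : ℂ) - (Real.sin (2 * Real.pi * x) : ℂ) * Complex.I := by
  rw [Real.fourierChar_apply, Complex.exp_mul_I, ← Complex.ofReal_cos, ← Complex.ofReal_sin]
  rw [mul_neg, Real.cos_neg, Real.sin_neg]
  push_cast
  ring

/-- Weak gradients are tested on real functions, so the character is split into cosine and sine. -/
theorem fourier_ofReal_eq {X : Vel d → ℝ} (hX : Integrable X) (ζ : Vel d) :
    𝓕 (fun v => (X v : ℂ)) ζ =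
      ((∫ v, Real.cos (2 * Real.pi * inner ℝ v ζ) * X v : ℝ) : ℂ) -
      ((∫ v, Real.sin (2 * Real.pi * inner ℝ v ζ) * X v : ℝ) : ℂ) * Complex.I := by
  have ic : Integrable fun v => Real.cos (2 * Real.pi * inner ℝ v ζ) * X v :=
    hX.bdd_mul (c := 1) (by fun_prop) (Eventually.of_forall fun v => Real.abs_cos_le_one _)
  have is : Integrable fun v => Real.sin (2 * Real.pi * inner ℝ v ζ) * X v :=
    hX.bdd_mul (c := 1) (by fun_prop) (Eventually.of_forall fun v => Real.abs_sin_le_one _)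
  rw [Real.fourier_eq, ← integral_complex_ofReal, ← integral_complex_ofReal, ← integral_mul_const,
    ← integral_sub ic.ofReal (is.ofReal.mul_const _)]
  congr with v
  rw [Circle.smul_def, fourierChar_neg_eq]
  push_cast
  rw [smul_eq_mul]
  ring

/-- The Fourier transform of an integrable weak gradient. -/
theorem IsWeakGradient.fourier_inner {F : Vel d → ℝ} {G : Vel d → Vel d}
    (h : IsWeakGradient F G) (hF : Integrable F) (hG : Integrable G) (k ζ : Vel d) :
    𝓕 (fun v => ((inner ℝ k (G v) : ℝ) : ℂ)) ζ =
      2 * Real.pi * Complex.I * (inner ℝ k ζ : ℝ) * 𝓕 (fun v => (F v : ℂ)) ζ := by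
  have hlin : ∀ v, HasFDerivAt (fun v : Vel d => 2 * Real.pi * inner ℝ v ζ)
      ((2 * Real.pi) • innerSL ℝ ζ) v := by
    intro v
    have := ((innerSL ℝ ζ).hasFDerivAt (x := v)).const_mul (2 * Real.pi)
    refine this.congr_of_eventuallyEq (Eventually.of_forall fun w => ?_)
    simp [real_inner_comm]
  have hfc : ∀ v, fderiv ℝ (fun v : Vel d => Real.cos (2 * Real.pi * inner ℝ v ζ)) v =
      -Real.sin (2 * Real.pi * inner ℝ v ζ) • ((2 * Real.pi) • innerSL ℝ ζ) :=
    fun v => ((hlin v).cos).fderiv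
  have hfs : ∀ v, fderiv ℝ (fun v : Vel d => Real.sin (2 * Real.pi * inner ℝ v ζ)) v =
      Real.cos (2 * Real.pi * inner ℝ v ζ) • ((2 * Real.pi) • innerSL ℝ ζ) :=
    fun v => ((hlin v).sin).fderiv
  have hc : ContDiff ℝ ∞ (fun v : Vel d => Real.cos (2 * Real.pi * inner ℝ v ζ)) :=
    (contDiff_const.mul (contDiff_id.inner ℝ contDiff_const)).cos
  have hs : ContDiff ℝ ∞ (fun v : Vel d => Real.sin (2 * Real.pi * inner ℝ v ζ)) :=
    (contDiff_const.mul (contDiff_id.inner ℝ contDiff_const)).sin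
  have h1 := h.integral_mul_fderiv hF hG hc (fun v => Real.abs_cos_le_one _)
    (B := 1 * ‖((2 * Real.pi) • innerSL ℝ ζ : Vel d →L[ℝ] ℝ)‖) (fun v => by
      rw [hfc, norm_smul]
      gcongr
      rw [norm_neg]; exact Real.abs_sin_le_one _) k
  have h2 := h.integral_mul_fderiv hF hG hs (fun v => Real.abs_sin_le_one _)
    (B := 1 * ‖((2 * Real.pi) • innerSL ℝ ζ : Vel d →L[ℝ] ℝ)‖) (fun v => by
      rw [hfs, norm_smul]
      gcongr
      exact Real.abs_cos_le_one _) k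
  have ev1 : ∫ v, F v * fderiv ℝ (fun v : Vel d => Real.cos (2 * Real.pi * inner ℝ v ζ)) v k =
      -(2 * Real.pi * inner ℝ k ζ) * ∫ v, Real.sin (2 * Real.pi * inner ℝ v ζ) * F v := by
    rw [← integral_const_mul]
    congr with v
    rw [hfc]
    simp [real_inner_comm]
    ring
  have ev2 : ∫ v, F v * fderiv ℝ (fun v : Vel d => Real.sin (2 * Real.pi * inner ℝ v ζ)) v k =
      (2 * Real.pi * inner ℝ k ζ) * ∫ v, Real.cos (2 * Real.pi * inner ℝ v ζ) * F v := by
    rw [← integral_const_mul]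
    congr with v
    rw [hfs]
    simp [real_inner_comm]
    ring
  rw [ev1] at h1
  rw [ev2] at h2
  rw [fourier_ofReal_eq (hG.const_inner k), fourier_ofReal_eq hF]
  have h1' : ∫ v, Real.cos (2 * Real.pi * inner ℝ v ζ) * inner ℝ k (G v) =
    (2 * Real.pi * inner ℝ k ζ) * ∫ v, Real.sin (2 * Real.pi * inner ℝ v ζ) * F v := by linarith
  have h2' : ∫ v, Real.sin (2 * Real.pi * inner ℝ v ζ) * inner ℝ k (G v) =
    -((2 * Real.pi * inner ℝ k ζ) * ∫ v, Real.cos (2 * Real.pi * inner ℝ v ζ) * F v) := by linarith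
  rw [h1', h2']
  push_cast
  linear_combination ((2 * Real.pi * (inner ℝ k ζ : ℝ)) *
    ((∫ v, Real.sin (2 * Real.pi * inner ℝ v ζ) * F v : ℝ) : ℂ)) * Complex.I_sq

end LenardBalescu
end

/-! ### The Cauchy integral as a half-line Fourier integral. -/

noncomputable section
namespace LenardBalescu

variable {d : ℕ}

open FourierTransform

/-- The weighted restriction `t ↦ t F̂(-te)` of the Fourier transform to a ray. -/
def rayTransform (F : Vel d → ℝ) (e : Vel d) (t : ℝ) : ℂ :=
  t * 𝓕 (fun v => (F v : ℂ)) (-(t • e))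

/-- The boundary value `4π² ∫_0^∞ t F̂(-te) e^{-2πitx} dt` of the Cauchy integral. -/
def boundaryValue (F : Vel d → ℝ) (e : Vel d) (x : ℝ) : ℂ :=
  4 * Real.pi ^ 2 * ∫ t in Set.Ioi (0 : ℝ), (Real.fourierChar (-(t * x)) : ℂ) * rayTransform F e t

/-- The sign of the imaginary shift selects the half-line `t > 0`, on which `η > 0` supplies
exponential damping. -/
theorem inv_sub_mul_I_eq_integral (y η : ℝ) (hη : 0 < η) :
    ((y : ℂ) - η * Complex.I)⁻¹ = 2 * Real.pi * Complex.I *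
      ∫ t in Set.Ioi (0 : ℝ), Complex.exp ((-(2 * Real.pi * η) - 2 * Real.pi * y * Complex.I) * t) := by
  have ha : (-(2 * Real.pi * η) - 2 * Real.pi * y * Complex.I : ℂ).re < 0 := by
    simp
    positivity
  rw [integral_exp_mul_complex_Ioi ha 0]
  have hne : (y : ℂ) - η * Complex.I ≠ 0 := by
    intro h
    have := congrArg Complex.im h
    simp at this
    linarith
  have hfac : (-(2 * Real.pi * η) - 2 * Real.pi * y * Complex.I : ℂ) =
      -(2 * Real.pi * Complex.I) * ((y : ℂ) - η * Complex.I) := by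
    linear_combination (-(2 * Real.pi * η) : ℂ) * Complex.I_sq
  have hpi : (2 * Real.pi * Complex.I : ℂ) ≠ 0 := Complex.two_pi_I_ne_zero
  rw [hfac]
  simp only [Complex.ofReal_zero, mul_zero, Complex.exp_zero]
  field_simp

/-- Fubini is legitimate thanks to the damping at fixed `η`. The factor `4π² t` is the product of
`2πi` from the resolvent and `-2πi t` from the gradient at frequency `-te`. -/
theorem cauchyIntegral_eq {F : Vel d → ℝ} {G : Vel d → Vel d} (h : IsWeakGradient F G)
    (hF : Integrable F) (hG : Integrable G) {e : Vel d} (he : ‖e‖ = 1) (x : ℝ) {η : ℝ}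
    (hη : 0 < η) :
    cauchyIntegral G e x η = 4 * Real.pi ^ 2 * ∫ t in Set.Ioi (0 : ℝ),
      Real.exp (-(2 * Real.pi * η) * t) *
        ((Real.fourierChar (-(t * x)) : ℂ) * rayTransform F e t) := by
  have hGe : Integrable fun w => ((inner ℝ e (G w) : ℝ) : ℂ) := (hG.const_inner e).ofReal
  have hexp : Integrable (fun t : ℝ => (Real.exp (-(2 * Real.pi * η) * t) : ℂ))
      (volume.restrict (Set.Ioi 0)) := by
    have := integrableOn_exp_mul_Ioi (a := -(2 * Real.pi * η))
      (by have := Real.pi_pos; nlinarith [mul_pos this hη]) 0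
    exact this.ofReal
  let J : Vel d → ℝ → ℂ := fun w t => ((inner ℝ e (G w) : ℝ) : ℂ) *
    (Complex.exp ((-(2 * Real.pi * η) - 2 * Real.pi * (x - inner ℝ e w : ℝ) * Complex.I) * t))
  have hJeq : ∀ w t, J w t = ((Real.exp (-(2 * Real.pi * η) * t) : ℂ) *
      (Real.fourierChar (-(t * x)) : ℂ)) * ((Real.fourierChar (-(inner ℝ w (-(t • e)))) : ℂ) *
        ((inner ℝ e (G w) : ℝ) : ℂ)) := by
    intro w t
    simp only [J]
    rw [Real.fourierChar_apply, Real.fourierChar_apply, Complex.ofReal_exp]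
    rw [mul_comm, ← mul_assoc, ← Complex.exp_add, ← Complex.exp_add]
    congr 2
    rw [inner_neg_right, inner_smul_right, real_inner_comm]
    push_cast
    ring
  have hJ : Integrable (Function.uncurry J) (volume.prod (volume.restrict (Set.Ioi 0))) := by
    have h1 := hGe.mul_prod hexp
    refine h1.mono ?_ (Eventually.of_forall fun p => le_of_eq ?_)
    · refine hGe.aestronglyMeasurable.comp_fst.mul (Continuous.aestronglyMeasurable ?_)
      fun_prop
    · obtain ⟨w, t⟩ := p
      simp only [Function.uncurry, hJeq, norm_mul, Circle.norm_coe, mul_one, one_mul]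
      ring
  have h1 : cauchyIntegral G e x η = 2 * Real.pi * Complex.I *
      ∫ w, ∫ t in Set.Ioi (0 : ℝ), J w t := by
    unfold cauchyIntegral
    rw [← integral_const_mul]
    congr with w
    rw [div_eq_mul_inv, inv_sub_mul_I_eq_integral _ _ hη, integral_const_mul]
    ring
  rw [h1, integral_integral_swap hJ, ← integral_const_mul, ← integral_const_mul]
  congr with t
  simp only [hJeq]
  rw [integral_const_mul]
  have h2 := h.fourier_inner hF hG e (-(t • e))
  rw [Real.fourier_eq] at h2
  simp only [Circle.smul_def, smul_eq_mul] at h2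
  rw [h2, rayTransform, inner_neg_right, inner_smul_right, real_inner_self_eq_norm_sq, he]
  push_cast
  linear_combination (-4 * Real.pi ^ 2 * t * Complex.exp (-(2 * Real.pi * η) * t) *
    (Real.fourierChar (-(t * x)) : ℂ) * 𝓕 (fun v => (F v : ℂ)) (-(t • e)) : ℂ) * Complex.I_sq

theorem tendsto_cauchyIntegral_unit {F : Vel d → ℝ} {G : Vel d → Vel d} (h : IsWeakGradient F G)
    (hF : Integrable F) (hG : Integrable G) {e : Vel d} (he : ‖e‖ = 1)
    (hm : IntegrableOn (rayTransform F e) (Set.Ioi 0)) (x : ℝ) :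
    Tendsto (fun η => cauchyIntegral G e x η) (𝓝[>] (0 : ℝ)) (𝓝 (boundaryValue F e x)) := by
  have h1 : (fun η => cauchyIntegral G e x η) =ᶠ[𝓝[>] (0 : ℝ)] fun η =>
      4 * Real.pi ^ 2 * ∫ t in Set.Ioi (0 : ℝ), Real.exp (-(2 * Real.pi * η) * t) *
        ((Real.fourierChar (-(t * x)) : ℂ) * rayTransform F e t) := by
    filter_upwards [self_mem_nhdsWithin] with η hη
    exact cauchyIntegral_eq h hF hG he x hη
  refine Tendsto.congr' h1.symm ?_
  refine Tendsto.const_mul _ ?_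
  refine tendsto_integral_filter_of_dominated_convergence (fun t => ‖rayTransform F e t‖) ?_ ?_
    hm.norm ?_
  · refine Eventually.of_forall fun η => ?_
    refine AEStronglyMeasurable.mul ?_ (AEStronglyMeasurable.mul ?_ hm.aestronglyMeasurable)
    · exact (by fun_prop : Continuous fun t : ℝ =>
        (Real.exp (-(2 * Real.pi * η) * t) : ℂ)).aestronglyMeasurable
    · refine Continuous.aestronglyMeasurable ?_
      exact continuous_subtype_val.comp (Real.continuous_fourierChar.comp (by fun_prop))
  · filter_upwards [self_mem_nhdsWithin] with η hη
    filter_upwards [self_mem_ae_restrict measurableSet_Ioi] with t ht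
    rw [norm_mul, norm_mul, Circle.norm_coe, one_mul, Complex.norm_real,
      Real.norm_of_nonneg (Real.exp_nonneg _)]
    refine mul_le_of_le_one_left (norm_nonneg _) ?_
    rw [Real.exp_le_one_iff]
    have h2 : 0 < 2 * Real.pi * η := mul_pos Real.two_pi_pos hη
    have : 0 < t := ht
    nlinarith
  · refine Eventually.of_forall fun t => ?_
    have hc : Continuous fun η : ℝ => (Real.exp (-(2 * Real.pi * η) * t) : ℂ) *
      ((Real.fourierChar (-(t * x)) : ℂ) * rayTransform F e t) := by fun_prop
    have := (hc.tendsto 0).mono_left (nhdsWithin_le_nhds (s := Set.Ioi 0))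
    simpa using this

/-- The integrand is homogeneous of degree zero in `(k, τ, η)`, which reduces the limit `η ↓ 0` to
unit vectors. -/
theorem cauchyIntegral_smul (G : Vel d → Vel d) {a : ℝ} (ha : 0 < a) (e : Vel d) (x η : ℝ) :
    cauchyIntegral G (a • e) (a * x) η = cauchyIntegral G e x (η / a) := by
  unfold cauchyIntegral
  congr with w
  have ha' : (a : ℂ) ≠ 0 := by exact_mod_cast ha.ne'
  rw [inner_smul_left, inner_smul_left]
  simp only [conj_trivial]
  have hden : (((a * x - a * inner ℝ e w : ℝ) : ℂ) - (η : ℂ) * Complex.I) =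
      a * (((x - inner ℝ e w : ℝ) : ℂ) - ((η / a : ℝ) : ℂ) * Complex.I) := by
    push_cast
    field_simp
  rw [hden, Complex.ofReal_mul, mul_div_mul_left _ _ ha']

theorem tendsto_cauchyIntegral {F : Vel d → ℝ} {G : Vel d → Vel d} (h : IsWeakGradient F G)
    (hF : Integrable F) (hG : Integrable G) {e : Vel d} (he : ‖e‖ = 1)
    (hm : IntegrableOn (rayTransform F e) (Set.Ioi 0)) {a : ℝ} (ha : 0 < a) (x : ℝ) :
    Tendsto (fun η => cauchyIntegral G (a • e) (a * x) η) (𝓝[>] (0 : ℝ))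
      (𝓝 (boundaryValue F e x)) := by
  simp only [cauchyIntegral_smul G ha]
  refine (tendsto_cauchyIntegral_unit h hF hG he hm x).comp ?_
  refine tendsto_nhdsWithin_iff.2 ⟨?_, ?_⟩
  · have : Tendsto (fun η : ℝ => η / a) (𝓝 0) (𝓝 (0 / a)) := tendsto_id.div_const a
    rw [zero_div] at this
    exact this.mono_left nhdsWithin_le_nhds
  · filter_upwards [self_mem_nhdsWithin] with η hη
    exact div_pos hη ha

/-- A density whose dispersion function is given by the boundary value formula. -/
structure IsAdmissible (F : Vel d → ℝ) : Prop where
  integrable : Integrable F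
  weakGradient : ∃ G, IsWeakGradient F G ∧ Integrable G
  ray : ∀ e : Vel d, ‖e‖ = 1 → IntegrableOn (rayTransform F e) (Set.Ioi 0)

theorem IsAdmissible.tendsto {F : Vel d → ℝ} (h : IsAdmissible F) {e : Vel d} (he : ‖e‖ = 1)
    {a : ℝ} (ha : 0 < a) (x : ℝ) :
    Tendsto (fun η => cauchyIntegral (LenardBalescu.weakGradient F) (a • e) (a * x) η)
      (𝓝[>] (0 : ℝ)) (𝓝 (boundaryValue F e x)) := by
  obtain ⟨G, hG, -⟩ := h.weakGradient
  exact tendsto_cauchyIntegral (isWeakGradient_weakGradient ⟨G, hG⟩) h.integrable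
    (integrable_weakGradient h.weakGradient) he (h.ray e he) ha x

theorem eq_norm_smul_unit {k : Vel d} (hk : k ≠ 0) :
    ‖‖k‖⁻¹ • k‖ = 1 ∧ ∀ v : Vel d, k = ‖k‖ • (‖k‖⁻¹ • k) ∧
      (inner ℝ k v : ℝ) = ‖k‖ * inner ℝ (‖k‖⁻¹ • k) v := by
  have hk' : ‖k‖ ≠ 0 := norm_ne_zero_iff.2 hk
  refine ⟨by rw [norm_smul, norm_inv, norm_norm, inv_mul_cancel₀ hk'], fun v => ⟨?_, ?_⟩⟩
  · rw [smul_smul, mul_inv_cancel₀ hk', one_smul]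
  · rw [inner_smul_left]
    simp only [conj_trivial]
    rw [← mul_assoc, mul_inv_cancel₀ hk', one_mul]

theorem IsAdmissible.tendsto_inner {F : Vel d → ℝ} (h : IsAdmissible F) {k : Vel d} (hk : k ≠ 0)
    (v : Vel d) :
    Tendsto (fun η => cauchyIntegral (LenardBalescu.weakGradient F) k (inner ℝ k v) η)
      (𝓝[>] (0 : ℝ)) (𝓝 (boundaryValue F (‖k‖⁻¹ • k) (inner ℝ (‖k‖⁻¹ • k) v))) := by
  obtain ⟨he, h2⟩ := eq_norm_smul_unit hk
  have := h.tendsto he (norm_pos_iff.2 hk) (inner ℝ (‖k‖⁻¹ • k) v)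
  rwa [← (h2 v).2, ← (h2 v).1] at this

theorem cauchyIntegral_zero (G : Vel d → Vel d) (x η : ℝ) : cauchyIntegral G 0 x η = 0 := by
  simp [cauchyIntegral]

theorem IsAdmissible.dispersionDefined {F : Vel d → ℝ} (h : IsAdmissible F) :
    DispersionDefined F := by
  refine ⟨h.weakGradient.imp fun G hG => hG.1, integrable_weakGradient h.weakGradient,
    fun k v => ?_⟩
  rcases eq_or_ne k 0 with rfl | hk
  · exact ⟨0, by simp only [cauchyIntegral_zero]; exact tendsto_const_nhds⟩
  · exact ⟨_, h.tendsto_inner hk v⟩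

theorem dispersion_zero (V : Vel d → ℝ) (x : ℝ) (G : Vel d → Vel d) : dispersion V 0 x G = 1 := by
  simp only [dispersion, cauchyIntegral_zero]
  rw [tendsto_const_nhds.limUnder_eq]
  simp

theorem IsAdmissible.dispersion_eq {F : Vel d → ℝ} (h : IsAdmissible F) (V : Vel d → ℝ)
    {k : Vel d} (hk : k ≠ 0) (v : Vel d) :
    dispersion V k (inner ℝ k v) (LenardBalescu.weakGradient F) = 1 + potentialHat V k *
      boundaryValue F (‖k‖⁻¹ • k) (inner ℝ (‖k‖⁻¹ • k) v) := by
  rw [dispersion, (h.tendsto_inner hk v).limUnder_eq]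

theorem norm_boundaryValue_le (F : Vel d → ℝ) (e : Vel d) (x : ℝ) :
    ‖boundaryValue F e x‖ₑ ≤ ENNReal.ofReal (4 * Real.pi ^ 2) *
      ∫⁻ t in Set.Ioi (0 : ℝ), ‖rayTransform F e t‖ₑ := by
  rw [boundaryValue, enorm_mul]
  gcongr
  · rw [← ofReal_norm]
    simp
  · refine (enorm_integral_le_lintegral_enorm _).trans (le_of_eq ?_)
    congr with t
    rw [enorm_mul, ← ofReal_norm, Circle.norm_coe, ENNReal.ofReal_one, one_mul]

end LenardBalescu
end

/-! ### Ray moments and velocity derivatives. -/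

noncomputable section
namespace LenardBalescu

variable {d : ℕ}

open FourierTransform

/-- The moment `∫_0^∞ (1 + t)^n |t F̂(-te)| dt`. -/
def rayMoment (n : ℕ) (F : Vel d → ℝ) (e : Vel d) : ℝ≥0∞ :=
  ∫⁻ t in Set.Ioi (0 : ℝ), ENNReal.ofReal ((1 + ‖t‖) ^ n) * ‖rayTransform F e t‖ₑ

theorem continuous_rayTransform {F : Vel d → ℝ} (hF : Integrable F) (e : Vel d) :
    Continuous (rayTransform F e) := by
  have := continuous_fourier_of_integrable hF.ofReal (f := fun v => (F v : ℂ))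
  unfold rayTransform
  fun_prop

theorem integrableOn_rayTransform {n : ℕ} {F : Vel d → ℝ} (hF : Integrable F) {e : Vel d}
    (h : rayMoment n F e < ⊤) {m : ℕ} (hm : m ≤ n) :
    IntegrableOn (fun t => ‖t‖ ^ m * ‖rayTransform F e t‖) (Set.Ioi 0) := by
  refine ⟨?_, ?_⟩
  · exact ((continuous_norm.pow m).mul (continuous_rayTransform hF e).norm).aestronglyMeasurable
  · refine lt_of_le_of_lt (lintegral_mono fun t => ?_) h
    rw [enorm_mul, enorm_norm, ← ofReal_norm, Real.norm_of_nonneg (by positivity)]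
    gcongr
    calc ‖t‖ ^ m ≤ (1 + ‖t‖) ^ m := by gcongr; simp
      _ ≤ _ := pow_le_pow_right₀ (by simp) hm

theorem integrableOn_rayTransform_of_moment {n : ℕ} {F : Vel d → ℝ} (hF : Integrable F) {e : Vel d}
    (h : rayMoment n F e < ⊤) : IntegrableOn (rayTransform F e) (Set.Ioi 0) := by
  have := integrableOn_rayTransform hF h (Nat.zero_le n)
  simp only [pow_zero, one_mul] at this
  exact (integrable_norm_iff (continuous_rayTransform hF e).aestronglyMeasurable).1 this

theorem enorm_boundaryValue_le (n : ℕ) (F : Vel d → ℝ) (e : Vel d) (x : ℝ) :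
    ‖boundaryValue F e x‖ₑ ≤ ENNReal.ofReal (4 * Real.pi ^ 2) * rayMoment n F e := by
  refine (norm_boundaryValue_le F e x).trans ?_
  gcongr
  refine lintegral_mono fun t => ?_
  refine le_mul_of_one_le_left' ?_
  rw [← ENNReal.ofReal_one]
  exact ENNReal.ofReal_le_ofReal (one_le_pow₀ (by simp))

/-- The pairing `(t, v) ↦ t e·v`. -/
def rayPairing (e : Vel d) : ℝ →L[ℝ] Vel d →L[ℝ] ℝ :=
  ContinuousLinearMap.smulRight (1 : ℝ →L[ℝ] ℝ) (innerSL ℝ e)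

theorem rayPairing_apply (e : Vel d) (t : ℝ) (v : Vel d) : rayPairing e t v = t * inner ℝ e v := by
  simp [rayPairing]

theorem norm_rayPairing_le {e : Vel d} (he : ‖e‖ = 1) : ‖rayPairing e‖ ≤ 1 := by
  refine ContinuousLinearMap.opNorm_le_bound _ zero_le_one fun t => ?_
  refine ContinuousLinearMap.opNorm_le_bound _ (by positivity) fun v => ?_
  rw [rayPairing_apply, norm_mul, one_mul]
  gcongr
  have := norm_inner_le_norm (𝕜 := ℝ) e v
  rwa [he, one_mul] at this

/-- In this form each derivative in `v` costs one power of `t`, by the general differentiation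
theorem for Fourier integrals with respect to a bilinear pairing. -/
theorem boundaryValue_eq_fourierIntegral (F : Vel d → ℝ) (e v : Vel d) :
    boundaryValue F e (inner ℝ e v) = ((4 * Real.pi ^ 2 : ℝ) : ℂ) *
      VectorFourier.fourierIntegral Real.fourierChar (volume.restrict (Set.Ioi (0 : ℝ)))
        (rayPairing e).toLinearMap₁₂ (rayTransform F e) v := by
  rw [boundaryValue, VectorFourier.fourierIntegral]
  push_cast
  congr 2 with t

theorem contDiff_boundaryValue {n : ℕ} {F : Vel d → ℝ} (hF : Integrable F) {e : Vel d}
    (h : rayMoment n F e < ⊤) :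
    ContDiff ℝ (n : ℕ∞) (fun v : Vel d => boundaryValue F e (inner ℝ e v)) := by
  simp only [boundaryValue_eq_fourierIntegral]
  refine contDiff_const.mul ?_
  exact VectorFourier.contDiff_fourierIntegral (rayPairing e) fun m hm =>
    integrableOn_rayTransform hF h (by exact_mod_cast hm)

theorem enorm_iteratedFDeriv_boundaryValue_le {n : ℕ} {F : Vel d → ℝ} (hF : Integrable F)
    {e : Vel d} (he : ‖e‖ = 1) (h : rayMoment n F e < ⊤) (v : Vel d) :
    ‖iteratedFDeriv ℝ n (fun v : Vel d => boundaryValue F e (inner ℝ e v)) v‖ₑ ≤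
      ENNReal.ofReal (4 * Real.pi ^ 2 * (2 * Real.pi) ^ n) * rayMoment n F e := by
  have hint : ∀ m : ℕ, (m : ℕ∞) ≤ (n : ℕ∞) → Integrable (fun t => ‖t‖ ^ m * ‖rayTransform F e t‖)
      (volume.restrict (Set.Ioi (0 : ℝ))) := fun m hm =>
    integrableOn_rayTransform hF h (by exact_mod_cast hm)
  have hmeas : AEStronglyMeasurable (rayTransform F e) (volume.restrict (Set.Ioi (0 : ℝ))) :=
    (continuous_rayTransform hF e).aestronglyMeasurable
  set Φ := VectorFourier.fourierIntegral Real.fourierChar (volume.restrict (Set.Ioi (0 : ℝ)))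
        (rayPairing e).toLinearMap₁₂ (rayTransform F e)
  have hΦ : ContDiff ℝ (n : ℕ∞) Φ := VectorFourier.contDiff_fourierIntegral (rayPairing e) hint
  have heq : (fun v : Vel d => boundaryValue F e (inner ℝ e v)) =
      fun v => ((4 * Real.pi ^ 2 : ℝ)) • Φ v := by
    ext v; rw [boundaryValue_eq_fourierIntegral, Complex.real_smul]
  rw [heq, iteratedFDeriv_const_smul_apply' (hΦ.contDiffAt.of_le le_rfl), enorm_smul,
    VectorFourier.iteratedFDeriv_fourierIntegral (rayPairing e) hint hmeas le_rfl,
    ENNReal.ofReal_mul (by positivity), mul_assoc]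
  gcongr
  · rw [← ofReal_norm, Real.norm_of_nonneg (by positivity)]
  · unfold VectorFourier.fourierIntegral
    refine (enorm_integral_le_lintegral_enorm _).trans ?_
    unfold rayMoment
    rw [← lintegral_const_mul' _ _ ENNReal.ofReal_ne_top]
    refine lintegral_mono fun t => ?_
    rw [← mul_assoc, ← ENNReal.ofReal_mul (by positivity), ← ofReal_norm, ← ofReal_norm,
      ← ENNReal.ofReal_mul (by positivity), Circle.norm_smul]
    refine ENNReal.ofReal_le_ofReal ?_
    refine (VectorFourier.norm_fourierPowSMulRight_le (rayPairing e) (rayTransform F e) t n).trans ?_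
    refine mul_le_mul_of_nonneg_right ?_ (norm_nonneg _)
    have h1 := norm_rayPairing_le he
    have h2 : ‖t‖ ≤ 1 + ‖t‖ := by simp
    calc _ ≤ (2 * Real.pi * 1) ^ n * (1 + ‖t‖) ^ n := by gcongr
      _ = _ := by rw [mul_one]

theorem rayTransform_add {F F' : Vel d → ℝ} (hF : Integrable F) (hF' : Integrable F') (e : Vel d)
    (t : ℝ) : rayTransform (fun v => F v + F' v) e t = rayTransform F e t + rayTransform F' e t := by
  unfold rayTransform
  rw [← mul_add]
  congr 1
  simp only [Real.fourier_eq]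
  rw [← integral_add]
  · congr with v
    rw [Complex.ofReal_add, smul_add]
  · exact (Real.fourierIntegral_convergent_iff _).2 hF.ofReal
  · exact (Real.fourierIntegral_convergent_iff _).2 hF'.ofReal

theorem boundaryValue_add {F F' : Vel d → ℝ} (hF : Integrable F) (hF' : Integrable F') {e : Vel d}
    (h : IntegrableOn (rayTransform F e) (Set.Ioi 0))
    (h' : IntegrableOn (rayTransform F' e) (Set.Ioi 0)) (x : ℝ) :
    boundaryValue (fun v => F v + F' v) e x = boundaryValue F e x + boundaryValue F' e x := by
  unfold boundaryValue
  rw [← mul_add]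
  congr 1
  have hb : ∀ {f : ℝ → ℂ}, IntegrableOn f (Set.Ioi 0) →
      IntegrableOn (fun t => (Real.fourierChar (-(t * x)) : ℂ) * f t) (Set.Ioi 0) := by
    intro f hf
    refine Integrable.bdd_mul hf (c := 1) ?_ (Eventually.of_forall fun t => (Circle.norm_coe _).le)
    refine Continuous.aestronglyMeasurable ?_
    exact continuous_subtype_val.comp (Real.continuous_fourierChar.comp (by fun_prop))
  rw [← integral_add (hb h) (hb h')]
  congr with t
  rw [rayTransform_add hF hF', mul_add]

theorem rayMoment_add_le {F F' : Vel d → ℝ} (hF : Integrable F) (hF' : Integrable F') (n : ℕ)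
    (e : Vel d) :
    rayMoment n (fun v => F v + F' v) e ≤ rayMoment n F e + rayMoment n F' e := by
  unfold rayMoment
  rw [← lintegral_add_left]
  · refine lintegral_mono fun t => ?_
    rw [rayTransform_add hF hF', ← mul_add]
    gcongr
    exact enorm_add_le _ _
  · exact Measurable.mul (M := ℝ≥0∞) (by fun_prop)
      (continuous_rayTransform hF e).measurable.enorm

/-- The perturbation `√μ g` of the Maxwellian. -/
def perturbation (g : Vel d → ℝ) (v : Vel d) : ℝ := Real.sqrt (maxwellian v) * g v

/-- The factor `t` in the ray transform raises the moment from `n` to `n + 1`, and Cauchy–Schwarz on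
the line requires `s > n + 1 + 1/2`. -/
theorem exists_rayMoment_perturbation_le (r s : ℝ) (n : ℕ) (hs : n + 3 / 2 < s) :
    ∃ C : ℝ≥0∞, C < ⊤ ∧ ∀ {g : Vel d → ℝ} (hg : MemLp g 2 volume)
      (h : Lp ℂ 2 (volume : Measure (Vel d))), Represents r s hg h →
      ∀ e : Vel d, ‖e‖ = 1 → rayMoment n (perturbation g) e ≤ C * ‖h‖ₑ := by
  have hn : (0 : ℝ) ≤ n := Nat.cast_nonneg n
  obtain ⟨C, hC, hCb⟩ := exists_lintegral_moment_le r s (n + 1) (by linarith) (by linarith)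
    (complexify (sqrtMaxwellian d))
  refine ⟨C, hC, fun {g} hg h hh e he => ?_⟩
  -- The ray transform evaluates at `-te`, so the line bound is used in direction `-e`.
  refine le_trans ?_ (hCb hg h hh (-e) (by rwa [norm_neg]))
  refine le_trans (lintegral_mono fun t => ?_) (setLIntegral_le_lintegral (Set.Ioi 0) _)
  have hfun : (fun v => ((perturbation g v : ℝ) : ℂ)) =
      fun v => complexify (sqrtMaxwellian d) v * (g v : ℂ) := by
    ext v
    rw [complexify_apply, sqrtMaxwellian_apply, perturbation, Complex.ofReal_mul]
  rw [rayTransform, hfun, enorm_mul, smul_neg, ← mul_assoc]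
  refine mul_le_mul_left ?_ _
  rw [← ofReal_norm, Complex.norm_real, ← ENNReal.ofReal_mul (by positivity)]
  refine ENNReal.ofReal_le_ofReal ?_
  have : (1 + ‖t‖) ^ ((n : ℝ) + 1) = (1 + ‖t‖) ^ n * (1 + ‖t‖) := by
    rw [← pow_succ, ← Real.rpow_natCast]; push_cast; rfl
  rw [this]
  gcongr
  simp

theorem fourier_maxwellian (ζ : Vel d) :
    𝓕 (fun v => ((maxwellian v : ℝ) : ℂ)) ζ = (Real.exp (-Real.pi ^ 2 * ‖ζ‖ ^ 2) : ℂ) := by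
  have h1 : (fun v : Vel d => ((maxwellian v : ℝ) : ℂ)) = fun v =>
      (((1 / Real.pi) ^ ((d : ℝ) / 2) : ℝ) : ℂ) • Complex.exp (-1 * ‖v‖ ^ 2) := by
    ext v
    simp [maxwellian]
  have h2 := fourier_gaussian_innerProductSpace (V := Vel d) (b := 1) (by simp) ζ
  have h3 : 𝓕 (fun v : Vel d => (((1 / Real.pi) ^ ((d : ℝ) / 2) : ℝ) : ℂ) •
      Complex.exp (-1 * ‖v‖ ^ 2)) ζ = (((1 / Real.pi) ^ ((d : ℝ) / 2) : ℝ) : ℂ) •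
      𝓕 (fun v : Vel d => Complex.exp (-1 * ‖v‖ ^ 2)) ζ := by
    simp only [Real.fourier_eq]
    rw [← integral_smul]
    congr with v
    rw [smul_comm]
  rw [h1, h3, h2, finrank_euclideanSpace, Fintype.card_fin, smul_eq_mul, ← mul_assoc]
  have h4 : ((Real.pi : ℂ) / 1) ^ ((d : ℂ) / 2) = ((Real.pi ^ ((d : ℝ) / 2) : ℝ) : ℂ) := by
    rw [Complex.ofReal_cpow Real.pi_pos.le]; push_cast; rw [div_one]
  rw [h4, ← Complex.ofReal_mul, ← Real.mul_rpow (by positivity) (by positivity),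
    one_div_mul_cancel Real.pi_ne_zero, Real.one_rpow]
  push_cast
  rw [one_mul, div_one]

theorem rayTransform_maxwellian {e : Vel d} (he : ‖e‖ = 1) (t : ℝ) :
    rayTransform maxwellian e t = ((t * Real.exp (-Real.pi ^ 2 * t ^ 2) : ℝ) : ℂ) := by
  rw [rayTransform, fourier_maxwellian, norm_neg, norm_smul, he, mul_one, Real.norm_eq_abs, sq_abs,
    Complex.ofReal_mul]

theorem exists_rayMoment_maxwellian_le (d n : ℕ) :
    ∃ C : ℝ≥0∞, C < ⊤ ∧ ∀ e : Vel d, ‖e‖ = 1 → rayMoment n maxwellian e ≤ C := by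
  -- The exponent counts `n` for the weight, 1 for the factor `t`, and 2 for the integrable tail `(1
  -- + |t|)^{-2}`.
  let K : ℝ := (n + 1 + 2).factorial * Real.exp (1 + 1 / (4 * Real.pi ^ 2))
  refine ⟨ENNReal.ofReal K * ∫⁻ t : ℝ, decay 2 t, ENNReal.mul_lt_top (by simp)
    (lintegral_decay_lt_top volume (by simp)), fun e he => ?_⟩
  rw [← lintegral_const_mul' _ _ (by simp)]
  refine le_trans (lintegral_mono fun t => ?_) (setLIntegral_le_lintegral (Set.Ioi 0) _)
  unfold decay
  rw [rayTransform_maxwellian he, ← ofReal_norm, Complex.norm_real,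
    ← ENNReal.ofReal_mul (by positivity), ← ENNReal.ofReal_mul (by positivity)]
  refine ENNReal.ofReal_le_ofReal ?_
  have h1 := one_add_pow_mul_exp_le (Real.pi ^ 2) (by positivity) (n + 1 + 2) ‖t‖ (norm_nonneg t)
  have h2 : (1 + ‖t‖) ^ (-(2 : ℝ)) = ((1 + ‖t‖) ^ 2)⁻¹ := by
    rw [Real.rpow_neg (by positivity)]; norm_cast
  rw [h2, ← div_eq_mul_inv, le_div_iff₀ (by positivity)]
  rw [norm_mul, Real.norm_of_nonneg (Real.exp_nonneg _)]
  have ht : t ^ 2 = ‖t‖ ^ 2 := by simp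
  rw [ht]
  calc _ ≤ (1 + ‖t‖) ^ n * ((1 + ‖t‖) * Real.exp (-Real.pi ^ 2 * ‖t‖ ^ 2)) * (1 + ‖t‖) ^ 2 := by
        gcongr; simp
    _ = (1 + ‖t‖) ^ (n + 1 + 2) * Real.exp (-Real.pi ^ 2 * ‖t‖ ^ 2) := by ring
    _ ≤ _ := h1

theorem isAdmissible_maxwellian : IsAdmissible (maxwellian (d := d)) where
  integrable := integrable_maxwellian
  weakGradient := exists_isWeakGradient_maxwellian
  ray e he := by
    obtain ⟨C, hC, hCb⟩ := exists_rayMoment_maxwellian_le d 0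
    exact integrableOn_rayTransform_of_moment integrable_maxwellian ((hCb e he).trans_lt hC)

theorem rayMoment_perturbed_le {g : Vel d → ℝ} (hg : MemLp g 2 volume) (n : ℕ) (e : Vel d) :
    rayMoment n (perturbed g) e ≤ rayMoment n maxwellian e + rayMoment n (perturbation g) e :=
  rayMoment_add_le integrable_maxwellian (integrable_sqrtMaxwellian_mul hg) n e

theorem isAdmissible_perturbed (r s : ℝ) (hs : 3 / 2 < s) {g : Vel d → ℝ} (hg : MemLp g 2 volume)
    (h : Lp ℂ 2 (volume : Measure (Vel d))) (hh : Represents r s hg h) :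
    IsAdmissible (perturbed g) where
  integrable := integrable_perturbed hg
  weakGradient := exists_isWeakGradient_perturbed r s (by linarith) hg h hh
  ray e he := by
    obtain ⟨C, hC, hCb⟩ := exists_rayMoment_maxwellian_le d 0
    obtain ⟨C', hC', hCb'⟩ := exists_rayMoment_perturbation_le (d := d) r s 0 (by simpa using hs)
    refine integrableOn_rayTransform_of_moment (n := 0) (integrable_perturbed hg) ?_
    refine (rayMoment_perturbed_le hg 0 e).trans_lt (ENNReal.add_lt_top.2 ⟨?_, ?_⟩)
    · exact (hCb e he).trans_lt hC
    · exact (hCb' hg h hh e he).trans_lt (ENNReal.mul_lt_top hC' (by simp))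

end LenardBalescu
end

/-! ### The Penrose condition for the Gaussian. -/

noncomputable section
namespace LenardBalescu

open FourierTransform

/-- The function `t ↦ t e^{-π²t²}`. -/
def gaussMoment (t : ℝ) : ℂ := ((t * Real.exp (-Real.pi ^ 2 * t ^ 2) : ℝ) : ℂ)

/-- The half-line Fourier transform of `t e^{-π²t²}`. -/
def halfGauss (x : ℝ) : ℂ :=
  ∫ t in Set.Ioi (0 : ℝ), (Real.fourierChar (-(t * x)) : ℂ) * gaussMoment t

theorem integrable_gaussMoment : Integrable gaussMoment := by
  have := integrable_mul_exp_neg_mul_sq (b := Real.pi ^ 2) (by positivity)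
  exact this.ofReal

theorem halfGauss_eq_fourier :
    halfGauss = 𝓕 ((Set.Ioi (0 : ℝ)).indicator gaussMoment) := by
  ext x
  rw [Real.fourier_real_eq, halfGauss, ← integral_indicator measurableSet_Ioi]
  congr with t
  by_cases ht : t ∈ Set.Ioi (0 : ℝ)
  · simp [ht, Circle.smul_def]
  · simp [ht]

theorem continuous_halfGauss : Continuous halfGauss := by
  rw [halfGauss_eq_fourier]
  exact VectorFourier.fourierIntegral_continuous Real.continuous_fourierChar
    (L := innerₗ ℝ) continuous_inner (integrable_gaussMoment.indicator measurableSet_Ioi)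

theorem tendsto_halfGauss : Tendsto halfGauss (cocompact ℝ) (𝓝 0) := by
  rw [halfGauss_eq_fourier]
  exact Real.zero_at_infty_fourier _

theorem halfGauss_zero_re_nonneg : 0 ≤ (halfGauss 0).re := by
  have h : halfGauss 0 = ((∫ t in Set.Ioi (0 : ℝ), t * Real.exp (-Real.pi ^ 2 * t ^ 2) : ℝ) : ℂ) := by
    rw [halfGauss, ← integral_complex_ofReal]
    congr with t
    simp [gaussMoment]
  rw [h, Complex.ofReal_re]
  refine setIntegral_nonneg measurableSet_Ioi fun t ht => ?_
  have : (0 : ℝ) < t := ht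
  positivity

/-- Since `gaussMoment` is real and odd, the negative half-line contributes minus the conjugate of
the positive one. The full transform thus isolates the imaginary part of `halfGauss`. -/
theorem fourier_gaussMoment_eq (x : ℝ) :
    𝓕 gaussMoment x = halfGauss x - (starRingEnd ℂ) (halfGauss x) := by
  have hi : Integrable fun t : ℝ => (Real.fourierChar (-(t * x)) : ℂ) * gaussMoment t := by
    refine Integrable.bdd_mul integrable_gaussMoment (c := 1) ?_
      (Eventually.of_forall fun t => (Circle.norm_coe _).le)
    refine Continuous.aestronglyMeasurable ?_
    exact continuous_subtype_val.comp (Real.continuous_fourierChar.comp (by fun_prop))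
  have h1 : 𝓕 gaussMoment x = ∫ t, (Real.fourierChar (-(t * x)) : ℂ) * gaussMoment t := by
    rw [Real.fourier_real_eq]
    rfl
  rw [h1, ← integral_add_compl (measurableSet_Iic (a := (0 : ℝ))) hi, Set.compl_Iic, add_comm,
    sub_eq_add_neg]
  congr 1
  rw [halfGauss, ← integral_conj, ← integral_neg]
  have h2 := integral_comp_neg_Ioi (0 : ℝ)
    (fun t : ℝ => (Real.fourierChar (-(t * x)) : ℂ) * gaussMoment t)
  rw [neg_zero] at h2
  rw [← h2]
  congr with t
  have hconj : (starRingEnd ℂ) (gaussMoment t) = gaussMoment t := Complex.conj_ofReal _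
  have hodd : gaussMoment (-t) = -gaussMoment t := by simp [gaussMoment]
  rw [map_mul, ← Circle.coe_inv_eq_conj, ← AddChar.map_neg_eq_inv, hconj, hodd, neg_mul, mul_neg]

/-- The left side is the derivative of the Fourier transform of `e^{-π²t²}`, which is an explicit
Gaussian. -/
theorem fourier_gaussMoment (x : ℝ) :
    -(2 * Real.pi * Complex.I) * 𝓕 gaussMoment x =
      1 / (Real.pi : ℂ) ^ (1 / 2 : ℂ) * (Complex.exp (-x ^ 2) * (-(2 * x))) := by
  let f : ℝ → ℂ := fun t => Complex.exp (-Real.pi * Real.pi * t ^ 2)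
  have hfm : ∀ t : ℝ, t • f t = gaussMoment t := by
    intro t
    simp only [f, gaussMoment, Complex.real_smul]
    push_cast
    ring_nf
  have hf : Integrable f := by
    have := integrable_cexp_neg_mul_sq (b := (Real.pi : ℂ) * Real.pi)
      (by rw [← Complex.ofReal_mul, Complex.ofReal_re]; positivity)
    refine this.congr (Eventually.of_forall fun t => ?_)
    simp only [f]
    ring_nf
  have h1 := Real.hasDerivAt_fourier hf (by simpa only [hfm] using integrable_gaussMoment) x
  have h2 : 𝓕 f = fun t : ℝ => 1 / (Real.pi : ℂ) ^ (1 / 2 : ℂ) * Complex.exp (-t ^ 2) := by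
    have := fourier_gaussian_pi (b := (Real.pi : ℂ)) (by simpa using Real.pi_pos)
    rw [this]
    ext t
    rw [neg_div, div_self (by exact_mod_cast Real.pi_ne_zero)]
    congr 2
    ring
  rw [h2] at h1
  have h3 : HasDerivAt (fun t : ℝ => 1 / (Real.pi : ℂ) ^ (1 / 2 : ℂ) * Complex.exp (-(t : ℂ) ^ 2))
      (1 / (Real.pi : ℂ) ^ (1 / 2 : ℂ) * (Complex.exp (-(x : ℂ) ^ 2) * (-(2 * x)))) x := by
    have h4 : HasDerivAt (fun z : ℂ => -z ^ 2) (-(2 * (x : ℂ))) (x : ℂ) := by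
      simpa using (hasDerivAt_pow 2 (x : ℂ)).fun_neg
    exact ((h4.cexp).comp_ofReal).const_mul _
  have h5 := h1.unique h3
  rw [← h5]
  have h6 : (fun t : ℝ => (-2 * Real.pi * Complex.I * t : ℂ) • f t) =
      fun t : ℝ => (-(2 * Real.pi * Complex.I)) • gaussMoment t := by
    ext t
    rw [← hfm, Complex.real_smul, smul_eq_mul, smul_eq_mul]
    ring
  rw [h6, Real.fourier_real_eq, Real.fourier_real_eq, ← smul_eq_mul, ← integral_smul]
  congr with t
  rw [smul_comm]

theorem halfGauss_im_ne_zero {x : ℝ} (hx : x ≠ 0) : (halfGauss x).im ≠ 0 := by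
  intro h
  have h1 := fourier_gaussMoment x
  have hc : (starRingEnd ℂ) (halfGauss x) = halfGauss x := Complex.conj_eq_iff_im.2 h
  rw [fourier_gaussMoment_eq, hc, sub_self, mul_zero] at h1
  have h2 : (1 / (Real.pi : ℂ) ^ (1 / 2 : ℂ) * (Complex.exp (-x ^ 2) * (-(2 * x)))) ≠ 0 := by
    refine mul_ne_zero (one_div_ne_zero ?_) (mul_ne_zero (Complex.exp_ne_zero _) ?_)
    · rw [Complex.cpow_ne_zero_iff]
      left
      exact_mod_cast Real.pi_ne_zero
    · simpa using hx
  exact h2 h1.symm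

/-- A zero needs `a · Im = 0`. If `a = 0` the value is 1; otherwise `x = 0`, where the real part is
at least 1. -/
theorem one_add_mul_halfGauss_ne_zero {a : ℝ} (ha : 0 ≤ a) (x : ℝ) :
    1 + (a : ℂ) * halfGauss x ≠ 0 := by
  intro h
  have him := congrArg Complex.im h
  have hre := congrArg Complex.re h
  simp at him hre
  rcases him with rfl | him
  · simp at hre
  · rcases eq_or_ne x 0 with rfl | hx
    · have := mul_nonneg ha halfGauss_zero_re_nonneg
      linarith
    · exact halfGauss_im_ne_zero hx him

/-- Uniform Penrose stability of the Maxwellian. -/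
theorem exists_le_norm_one_add_mul_halfGauss (A : ℝ) :
    ∃ c : ℝ, 0 < c ∧ ∀ a ∈ Set.Icc 0 A, ∀ x : ℝ, c ≤ ‖1 + (a : ℂ) * halfGauss x‖ := by
  by_cases hA : A < 0
  · exact ⟨1, one_pos, fun a ha => absurd (ha.1.trans ha.2) (not_le.2 hA)⟩
  push Not at hA
  -- By Riemann–Lebesgue the perturbation of 1 is below `1/2` outside a compact set `K`, uniformly
  -- in `a ≤ A`. On `[0, A] × K` the modulus is continuous and attains a positive minimum.
  have hsmall : ∀ᶠ x in cocompact ℝ, A * ‖halfGauss x‖ < 1 / 2 := by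
    have := (tendsto_halfGauss.norm.const_mul A)
    rw [norm_zero, mul_zero] at this
    exact this.eventually_lt_const (by norm_num)
  obtain ⟨K, hK, hKs⟩ := mem_cocompact.1 hsmall
  have hcont : Continuous fun p : ℝ × ℝ => ‖1 + (p.1 : ℂ) * halfGauss p.2‖ := by
    have := continuous_halfGauss
    fun_prop
  obtain ⟨c, hc, hcb⟩ : ∃ c : ℝ, 0 < c ∧ ∀ p ∈ Set.Icc 0 A ×ˢ K, c ≤ ‖1 + (p.1 : ℂ) * halfGauss p.2‖ := by
    rcases (Set.Icc 0 A ×ˢ K).eq_empty_or_nonempty with he | hne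
    · exact ⟨1, one_pos, fun p hp => by rw [he] at hp; exact hp.elim⟩
    · obtain ⟨p, hp, hpm⟩ := (isCompact_Icc.prod hK).exists_isMinOn hne hcont.continuousOn
      exact ⟨_, norm_pos_iff.2 (one_add_mul_halfGauss_ne_zero hp.1.1 p.2), fun q hq => hpm hq⟩
  refine ⟨min c (1 / 2), lt_min hc (by norm_num), fun a ha x => ?_⟩
  by_cases hx : x ∈ K
  · exact (min_le_left _ _).trans (hcb (a, x) ⟨ha, hx⟩)
  · refine (min_le_right _ _).trans ?_
    have h1 : A * ‖halfGauss x‖ < 1 / 2 := hKs hx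
    have h2 : ‖(a : ℂ) * halfGauss x‖ ≤ A * ‖halfGauss x‖ := by
      rw [norm_mul, Complex.norm_real, Real.norm_of_nonneg ha.1]
      gcongr
      exact ha.2
    have h3 := norm_sub_norm_le (1 : ℂ) (-((a : ℂ) * halfGauss x))
    rw [norm_neg, sub_neg_eq_add, norm_one] at h3
    linarith

theorem boundaryValue_maxwellian {d : ℕ} {e : Vel d} (he : ‖e‖ = 1) (x : ℝ) :
    boundaryValue maxwellian e x = ((4 * Real.pi ^ 2 : ℝ) : ℂ) * halfGauss x := by
  rw [boundaryValue, halfGauss]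
  push_cast
  congr 2 with t
  rw [rayTransform_maxwellian he, gaussMoment]

end LenardBalescu
end

/-! ### Uniform bounds and the three assertions. -/

noncomputable section
namespace LenardBalescu

variable {d : ℕ}

theorem norm_potentialHat_le (V : Vel d → ℝ) (k : Vel d) : ‖potentialHat V k‖ ≤ ∫ x, ‖V x‖ := by
  refine (norm_integral_le_integral_norm _).trans (le_of_eq ?_)
  congr with x
  rw [norm_mul, Complex.norm_real, ← neg_mul, ← Complex.ofReal_neg, Complex.norm_exp_ofReal_mul_I,
    one_mul]

theorem IsPositiveDefinite.exists_potentialHat_eq {V : Vel d → ℝ} (hV : IsPositiveDefinite V)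
    (k : Vel d) : ∃ a ∈ Set.Icc 0 (∫ x, ‖V x‖), potentialHat V k = (a : ℂ) := by
  refine ⟨(potentialHat V k).re, ⟨(hV k).1, ?_⟩, Complex.ext rfl (by simpa using (hV k).2)⟩
  exact (Complex.re_le_norm _).trans (norm_potentialHat_le V k)

theorem exists_norm_boundaryValue_maxwellian_le (d : ℕ) :
    ∃ B : ℝ, 0 ≤ B ∧ ∀ e : Vel d, ‖e‖ = 1 → ∀ x, ‖boundaryValue maxwellian e x‖ ≤ B := by
  obtain ⟨C, hC, hCb⟩ := exists_rayMoment_maxwellian_le d 0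
  refine ⟨4 * Real.pi ^ 2 * C.toReal, by positivity, fun e he x => ?_⟩
  rw [← ENNReal.ofReal_le_ofReal_iff (by positivity), ofReal_norm,
    ENNReal.ofReal_mul (by positivity), ENNReal.ofReal_toReal hC.ne]
  exact (enorm_boundaryValue_le 0 _ e x).trans (by gcongr; exact hCb e he)

theorem exists_norm_boundaryValue_perturbation_le (r s : ℝ) (hs : 3 / 2 < s) :
    ∃ B : ℝ, 0 ≤ B ∧ ∀ {g : Vel d → ℝ} (hg : MemLp g 2 volume)
      (h : Lp ℂ 2 (volume : Measure (Vel d))), Represents r s hg h →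
      ∀ e : Vel d, ‖e‖ = 1 → ∀ x, ‖boundaryValue (perturbation g) e x‖ ≤ B * ‖h‖ := by
  obtain ⟨C, hC, hCb⟩ := exists_rayMoment_perturbation_le (d := d) r s 0 (by simpa using hs)
  refine ⟨4 * Real.pi ^ 2 * C.toReal, by positivity, fun {g} hg h hh e he x => ?_⟩
  rw [← ENNReal.ofReal_le_ofReal_iff (by positivity), ofReal_norm,
    ENNReal.ofReal_mul (by positivity), ENNReal.ofReal_mul (by positivity),
    ENNReal.ofReal_toReal hC.ne, ofReal_norm, mul_assoc]
  exact (enorm_boundaryValue_le 0 _ e x).trans (by gcongr; exact hCb hg h hh e he)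

theorem exists_norm_iteratedFDeriv_boundaryValue_perturbed_le (r s : ℝ) (n : ℕ)
    (hs : n + 3 / 2 < s) :
    ∃ B : ℝ, 0 ≤ B ∧ ∀ {g : Vel d → ℝ} (hg : MemLp g 2 volume)
      (h : Lp ℂ 2 (volume : Measure (Vel d))), Represents r s hg h →
      ∀ e : Vel d, ‖e‖ = 1 →
        ContDiff ℝ (n : ℕ∞) (fun v : Vel d => boundaryValue (perturbed g) e (inner ℝ e v)) ∧
        ∀ v, ‖iteratedFDeriv ℝ n
          (fun v : Vel d => boundaryValue (perturbed g) e (inner ℝ e v)) v‖ ≤ B * (1 + ‖h‖) := by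
  obtain ⟨C, hC, hCb⟩ := exists_rayMoment_maxwellian_le d n
  obtain ⟨C', hC', hCb'⟩ := exists_rayMoment_perturbation_le (d := d) r s n hs
  set M : ℝ≥0∞ := max C C'
  have hM : M ≠ ⊤ := (max_lt hC hC').ne
  refine ⟨4 * Real.pi ^ 2 * (2 * Real.pi) ^ n * M.toReal, by positivity,
    fun {g} hg h hh e he => ?_⟩
  have hle : rayMoment n (perturbed g) e ≤ M * (1 + ‖h‖ₑ) := by
    refine (rayMoment_perturbed_le hg n e).trans ?_
    rw [mul_add, mul_one]
    exact add_le_add ((hCb e he).trans (le_max_left _ _))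
      ((hCb' hg h hh e he).trans (by gcongr; exact le_max_right _ _))
  have hlt : rayMoment n (perturbed g) e < ⊤ :=
    hle.trans_lt (ENNReal.mul_lt_top hM.lt_top (by simp))
  refine ⟨contDiff_boundaryValue (integrable_perturbed hg) hlt, fun v => ?_⟩
  rw [← ENNReal.ofReal_le_ofReal_iff (by positivity), ofReal_norm,
    ENNReal.ofReal_mul (by positivity), ENNReal.ofReal_mul (by positivity),
    ENNReal.ofReal_toReal hM, ENNReal.ofReal_add zero_le_one (norm_nonneg _), ofReal_norm,
    ENNReal.ofReal_one, mul_assoc]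
  exact (enorm_iteratedFDeriv_boundaryValue_le (integrable_perturbed hg) he hlt v).trans (by gcongr)

theorem exists_represents {r s : ℝ} {g : Vel d → ℝ} {hg : MemLp g 2 volume}
    (hN : weightedSobolevNorm r s hg ≠ ⊤) : ∃ h, Represents r s hg h := by
  by_contra! hne
  refine hN (iInf₂_eq_top.2 fun h hh => absurd hh (hne h))

/-- The norm is an infimum over representatives; an estimate valid for each of them passes to the
infimum, so their uniqueness is not needed. -/
theorem le_mul_weightedSobolevNorm {r s : ℝ} {g : Vel d → ℝ} {hg : MemLp g 2 volume}
    (hN : weightedSobolevNorm r s hg ≠ ⊤) {a B : ℝ} (hB : 0 ≤ B)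
    (h : ∀ h, Represents r s hg h → a ≤ B * ‖h‖) :
    a ≤ B * (weightedSobolevNorm r s hg).toReal := by
  rcases hB.eq_or_lt with rfl | hB
  · obtain ⟨f, hf⟩ := exists_represents hN
    simpa using h f hf
  · have h1 : ENNReal.ofReal (a / B) ≤ weightedSobolevNorm r s hg := by
      refine le_iInf₂ fun f hf => ?_
      rw [← ofReal_norm]
      refine ENNReal.ofReal_le_ofReal ?_
      rw [div_le_iff₀' hB]
      exact h f hf
    rw [← div_le_iff₀' hB]
    exact (ENNReal.ofReal_le_iff_le_toReal hN).1 h1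

/-- The Maxwellian satisfies the Penrose condition uniformly. -/
theorem exists_le_norm_one_add_mul_boundaryValue {V : Vel d → ℝ} (hV : IsPositiveDefinite V) :
    ∃ c : ℝ, 0 < c ∧ ∀ (k e : Vel d), ‖e‖ = 1 → ∀ x,
      c ≤ ‖1 + potentialHat V k * boundaryValue maxwellian e x‖ := by
  -- `0 ≤ V̂(k) ≤ ‖V‖_{L¹}`, so the coefficient `4π² V̂(k)` ranges in a fixed compact interval for
  -- all `k`.
  obtain ⟨c, hc, hcb⟩ := exists_le_norm_one_add_mul_halfGauss ((∫ x, ‖V x‖) * (4 * Real.pi ^ 2))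
  refine ⟨c, hc, fun k e he x => ?_⟩
  obtain ⟨a, ha, hk⟩ := hV.exists_potentialHat_eq k
  rw [hk, boundaryValue_maxwellian he, ← mul_assoc, ← Complex.ofReal_mul]
  refine hcb _ ⟨mul_nonneg ha.1 (by positivity), ?_⟩ x
  gcongr
  exact ha.2

theorem norm_one_add_mul_le {Λ B : ℝ} {a b : ℂ} (ha : ‖a‖ ≤ Λ) (hb : ‖b‖ ≤ B) :
    ‖1 + a * b‖ ≤ 1 + Λ * B := by
  refine (norm_add_le _ _).trans ?_
  rw [norm_one, norm_mul]
  have := (norm_nonneg a).trans ha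
  gcongr

theorem boundaryValue_perturbed {r s : ℝ} (hs : 3 / 2 < s) {g : Vel d → ℝ}
    (hg : MemLp g 2 volume) (h : Lp ℂ 2 (volume : Measure (Vel d))) (hh : Represents r s hg h)
    {e : Vel d} (he : ‖e‖ = 1) (x : ℝ) :
    boundaryValue (perturbed g) e x =
      boundaryValue maxwellian e x + boundaryValue (perturbation g) e x := by
  obtain ⟨C, hC, hCb⟩ := exists_rayMoment_perturbation_le (d := d) r s 0 (by simpa using hs)
  have hi : Integrable (perturbation g) := integrable_sqrtMaxwellian_mul hg
  refine boundaryValue_add integrable_maxwellian hi (isAdmissible_maxwellian.ray e he) ?_ x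
  exact integrableOn_rayTransform_of_moment (n := 0) hi
    ((hCb hg h hh e he).trans_lt (ENNReal.mul_lt_top hC (by simp)))

theorem maxwellian_nondegenerate {V : Vel d → ℝ} (hV : IsPositiveDefinite V) :
    ∃ C : ℝ, 1 ≤ C ∧ ∀ k v : Vel d,
      1 / C ≤ ‖dispersion V k (inner ℝ k v) (weakGradient maxwellian)‖ ∧
        ‖dispersion V k (inner ℝ k v) (weakGradient maxwellian)‖ ≤ C := by
  obtain ⟨c, hc, hcb⟩ := exists_le_norm_one_add_mul_boundaryValue hV
  obtain ⟨B, hB, hBb⟩ := exists_norm_boundaryValue_maxwellian_le d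
  have hΛ : 0 ≤ ∫ x, ‖V x‖ := integral_nonneg fun x => norm_nonneg _
  refine ⟨max (1 / c) (1 + (∫ x, ‖V x‖) * B), le_max_of_le_right (by nlinarith), fun k v => ?_⟩
  rcases eq_or_ne k 0 with rfl | hk
  · rw [dispersion_zero, norm_one]
    have : 1 ≤ max (1 / c) (1 + (∫ x, ‖V x‖) * B) := le_max_of_le_right (by nlinarith)
    exact ⟨(div_le_one (by linarith)).2 this, this⟩
  · have he := (eq_norm_smul_unit hk).1
    rw [isAdmissible_maxwellian.dispersion_eq V hk v]
    refine ⟨le_trans ?_ (hcb k _ he _), le_trans ?_ (le_max_right _ _)⟩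
    · rw [one_div_le (lt_max_of_lt_left (by positivity)) hc]
      exact le_max_left _ _
    · exact norm_one_add_mul_le (norm_potentialHat_le V k) (hBb _ he _)

/-- The boundary value is additive in the density, so the dispersion function differs from the
Maxwellian one by `V̂(k)` times a term linear in `g`, uniformly small when the norm is. -/
theorem perturbed_nondegenerate {V : Vel d → ℝ} (hV : IsPositiveDefinite V) (r s : ℝ)
    (hs : 3 / 2 < s) :
    ∃ C₀ C : ℝ, 1 ≤ C₀ ∧ 1 ≤ C ∧ ∀ (g : Vel d → ℝ) (hg : MemLp g 2 volume),
      weightedSobolevNorm r s hg ≤ ENNReal.ofReal (1 / C₀) →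
      DispersionDefined (perturbed g) ∧ ∀ k v : Vel d,
        1 / C ≤ ‖dispersion V k (inner ℝ k v) (weakGradient (perturbed g))‖ ∧
          ‖dispersion V k (inner ℝ k v) (weakGradient (perturbed g))‖ ≤ C := by
  obtain ⟨C₁, hC₁, hC₁b⟩ := maxwellian_nondegenerate hV
  obtain ⟨B, hB, hBb⟩ := exists_norm_boundaryValue_perturbation_le (d := d) r s hs
  have hΛ : 0 ≤ ∫ x, ‖V x‖ := integral_nonneg fun x => norm_nonneg _
  set Λ := ∫ x, ‖V x‖
  -- This `C₀` makes the difference at most `1/(2C₁)`, half of the Maxwellian lower bound. The upper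
  -- bound stays below `C₁ + 1 ≤ 2C₁`.
  refine ⟨1 + 2 * C₁ * (Λ * B), 2 * C₁, ?_, by linarith, fun g hg hN => ?_⟩
  · have : 0 ≤ 2 * C₁ * (Λ * B) := by positivity
    linarith
  have hNt : weightedSobolevNorm r s hg ≠ ⊤ := ne_top_of_le_ne_top ENNReal.ofReal_ne_top hN
  obtain ⟨h, hh⟩ := exists_represents hNt
  have hadm := isAdmissible_perturbed r s hs hg h hh
  refine ⟨hadm.dispersionDefined, fun k v => ?_⟩
  have hdiff : ‖dispersion V k (inner ℝ k v) (weakGradient (perturbed g)) -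
      dispersion V k (inner ℝ k v) (weakGradient maxwellian)‖ ≤ 1 / (2 * C₁) := by
    rcases eq_or_ne k 0 with rfl | hk
    · rw [dispersion_zero, dispersion_zero, sub_self, norm_zero]
      positivity
    have he := (eq_norm_smul_unit hk).1
    rw [hadm.dispersion_eq V hk v, isAdmissible_maxwellian.dispersion_eq V hk v,
      boundaryValue_perturbed hs hg h hh he, add_sub_add_left_eq_sub, ← mul_sub,
      add_sub_cancel_left, norm_mul]
    have h1 := le_mul_weightedSobolevNorm hNt hB fun f hf =>
      hBb hg f hf _ he (inner ℝ (‖k‖⁻¹ • k) v)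
    have h2 : (weightedSobolevNorm r s hg).toReal ≤ 1 / (1 + 2 * C₁ * (Λ * B)) :=
      ENNReal.toReal_le_of_le_ofReal (by positivity) hN
    calc _ ≤ Λ * (B * (1 / (1 + 2 * C₁ * (Λ * B)))) := by
          gcongr
          · exact norm_potentialHat_le V k
          · exact h1.trans (by gcongr)
      _ ≤ 1 / (2 * C₁) := by
          rw [← mul_assoc, mul_one_div, div_le_div_iff₀ (by positivity) (by positivity)]
          linarith
  obtain ⟨hl, hu⟩ := hC₁b k v
  set D := dispersion V k (inner ℝ k v) (weakGradient (perturbed g))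
  set D₁ := dispersion V k (inner ℝ k v) (weakGradient maxwellian)
  have h1 := norm_sub_norm_le D D₁
  have h2 := norm_sub_norm_le D₁ D
  rw [norm_sub_rev] at h2
  have h3 : 1 / C₁ = 1 / (2 * C₁) + 1 / (2 * C₁) := by field_simp; norm_num
  have h4 : 1 / (2 * C₁) ≤ 1 := by rw [div_le_one (by positivity)]; linarith
  exact ⟨by linarith, by linarith⟩

theorem norm_partialDeriv_le (α : Fin d → ℕ) (f : Vel d → ℂ) (v : Vel d) :
    ‖partialDeriv α f v‖ ≤ ‖iteratedFDeriv ℝ (∑ i, α i) f v‖ := by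
  refine (ContinuousMultilinearMap.le_opNorm _ _).trans (le_of_eq ?_)
  simp

/-- As `α ≠ 0`, the constant 1 is differentiated away; what remains is `V̂(k)` times a derivative of
the boundary value along the unit direction of `k`, so no power of `‖k‖` appears. -/
theorem partialDeriv_dispersion_bounded (V : Vel d → ℝ) (α : Fin d → ℕ) (hα : α ≠ 0) (r s : ℝ)
    (hs : ((∑ i, α i : ℕ) : ℝ) + 3 / 2 < s) :
    ∃ C : ℝ, 1 ≤ C ∧ ∀ (g : Vel d → ℝ) (hg : MemLp g 2 volume),
      weightedSobolevNorm r s hg ≠ ⊤ →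
      DispersionDefined (perturbed g) ∧ ∀ k : Vel d,
        ContDiff ℝ ((∑ i, α i : ℕ) : ℕ∞)
            (fun v => dispersion V k (inner ℝ k v) (weakGradient (perturbed g))) ∧
          ∀ v : Vel d,
            ‖partialDeriv α
                (fun w => dispersion V k (inner ℝ k w) (weakGradient (perturbed g))) v‖ ≤
              C * (1 + (weightedSobolevNorm r s hg).toReal) := by
  have hn : ∑ i, α i ≠ 0 := fun h => hα (funext fun i => by
    simpa using Finset.sum_eq_zero_iff.1 h i (Finset.mem_univ i))
  obtain ⟨B, hB, hBb⟩ :=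
    exists_norm_iteratedFDeriv_boundaryValue_perturbed_le (d := d) r s (∑ i, α i) hs
  have hΛ : 0 ≤ ∫ x, ‖V x‖ := integral_nonneg fun x => norm_nonneg _
  set Λ := ∫ x, ‖V x‖
  refine ⟨1 + Λ * B, by nlinarith, fun g hg hN => ?_⟩
  obtain ⟨h, hh⟩ := exists_represents hN
  have hs' : 3 / 2 < s := by
    have : (0 : ℝ) ≤ ((∑ i, α i : ℕ) : ℝ) := Nat.cast_nonneg _
    linarith
  have hadm := isAdmissible_perturbed r s hs' hg h hh
  refine ⟨hadm.dispersionDefined, fun k => ?_⟩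
  rcases eq_or_ne k 0 with rfl | hk
  · simp only [dispersion_zero]
    refine ⟨contDiff_const, fun v => ?_⟩
    refine (norm_partialDeriv_le _ _ _).trans ?_
    rw [iteratedFDeriv_const_of_ne hn, Pi.zero_apply, norm_zero]
    positivity
  simp only [hadm.dispersion_eq V hk]
  have he := (eq_norm_smul_unit hk).1
  set e := ‖k‖⁻¹ • k
  have hcd := (hBb hg h hh e he).1
  refine ⟨contDiff_const.add (contDiff_const.mul hcd), fun v => ?_⟩
  refine (norm_partialDeriv_le _ _ _).trans ?_
  have hD : iteratedFDeriv ℝ (∑ i, α i) (fun w => 1 + potentialHat V k *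
      boundaryValue (perturbed g) e (inner ℝ e w)) v = potentialHat V k •
      iteratedFDeriv ℝ (∑ i, α i) (fun w => boundaryValue (perturbed g) e (inner ℝ e w)) v := by
    simp only [← smul_eq_mul]
    rw [fun_iteratedFDeriv_add_apply contDiff_const.contDiffAt
      (hcd.const_smul (potentialHat V k)).contDiffAt, iteratedFDeriv_const_of_ne hn, Pi.zero_apply,
      zero_add, iteratedFDeriv_const_smul_apply' hcd.contDiffAt]
  rw [hD, norm_smul]
  have h1 : ‖iteratedFDeriv ℝ (∑ i, α i)
      (fun w => boundaryValue (perturbed g) e (inner ℝ e w)) v‖ ≤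
      B * (1 + (weightedSobolevNorm r s hg).toReal) := by
    -- Passing to the infimum requires a bound linear in `‖f‖`, so the constant term `B` is
    -- subtracted first.
    have := le_mul_weightedSobolevNorm hN hB fun f hf => sub_le_iff_le_add'.2
      (((hBb hg f hf e he).2 v).trans_eq (mul_one_add B ‖f‖))
    linarith
  calc _ ≤ Λ * (B * (1 + (weightedSobolevNorm r s hg).toReal)) := by
        gcongr
        exact norm_potentialHat_le V k
    _ ≤ _ := by
        rw [← mul_assoc]
        gcongr
        linarith

end LenardBalescu
end

open LenardBalescu in
theorem lemma2p1 (d : ℕ) (hd : 2 ≤ d) (V : EuclideanSpace ℝ (Fin d) → ℝ)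
    (hV : Integrable V) (hVpos : IsPositiveDefinite V) :
    -- (i) non-degeneracy at Maxwellian
    (DispersionDefined (maxwellian (d := d)) ∧
      ∃ C : ℝ, 1 ≤ C ∧ ∀ k v : EuclideanSpace ℝ (Fin d),
        1 / C ≤ ‖dispersion V k (inner ℝ k v) (weakGradient maxwellian)‖ ∧
          ‖dispersion V k (inner ℝ k v) (weakGradient maxwellian)‖ ≤ C) ∧
    -- (ii) non-degeneracy close to Maxwellian
    (∀ r₀ δ₀ : ℝ, 0 ≤ r₀ → 0 < δ₀ →
      ∃ C₀ C : ℝ, 1 ≤ C₀ ∧ 1 ≤ C ∧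
        ∀ (g : EuclideanSpace ℝ (Fin d) → ℝ) (hg : MemLp g 2),
          weightedSobolevNorm r₀ (3 / 2 + δ₀) hg ≤ ENNReal.ofReal (1 / C₀) →
          DispersionDefined (perturbed g) ∧
            ∀ k v : EuclideanSpace ℝ (Fin d),
              1 / C ≤ ‖dispersion V k (inner ℝ k v) (weakGradient (perturbed g))‖ ∧
                ‖dispersion V k (inner ℝ k v) (weakGradient (perturbed g))‖ ≤ C) ∧
    -- (iii) boundedness of derivatives
    (∀ (α : Fin d → ℕ) (δ r : ℝ), α ≠ 0 → 0 < δ → 0 ≤ r →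
      ∃ C : ℝ, 1 ≤ C ∧
        ∀ (g : EuclideanSpace ℝ (Fin d) → ℝ) (hg : MemLp g 2),
          weightedSobolevNorm r (((∑ i, α i : ℕ) : ℝ) + 3 / 2 + δ) hg ≠ ⊤ →
          DispersionDefined (perturbed g) ∧
            ∀ k : EuclideanSpace ℝ (Fin d),
              ContDiff ℝ ((∑ i, α i : ℕ) : ℕ∞)
                  (fun v => dispersion V k (inner ℝ k v) (weakGradient (perturbed g))) ∧
                ∀ v : EuclideanSpace ℝ (Fin d),
                  ‖partialDeriv α
                      (fun w => dispersion V k (inner ℝ k w) (weakGradient (perturbed g))) v‖ ≤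
                    C * (1 + (weightedSobolevNorm r (((∑ i, α i : ℕ) : ℝ) + 3 / 2 + δ) hg).toReal)) := by
  refine ⟨⟨isAdmissible_maxwellian.dispersionDefined, maxwellian_nondegenerate hVpos⟩,
    fun r₀ δ₀ _ hδ₀ => perturbed_nondegenerate hVpos r₀ _ (by linarith),
    fun α δ r hα hδ _ => partialDeriv_dispersion_bounded V α hα r _ (by linarith)⟩
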